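/- Let $m\ge 2$ and let $(M^m,g)$ be a smooth Riemannian manifold of dimension $m$ without boundary. Let $(N^{m+1},h)$ be one of the space forms $\mathbb{R}^{m+1}$ (flat metric), $H^{m+1}$ (hyperbolic space, sectional curvature $-1$) or $S^{m+1}$ (the unit sphere in $\mathbb{R}^{m+2}$ with the round metric), and let $\phi:(M^m,g)\to (N^{m+1},h)$ be a smooth isometric immersion (a hypersurface). For a smooth function $f:M\to(0,\infty)$, put $$\tau(\phi)=\mathrm{Trace}_g\nabla d\phi,\qquad \tau_2(\phi)=\mathrm{Trace}_g\big(\nabla^\phi\nabla^\phi-\nabla^\phi_{\nabla^M}\big)\tau(\phi)-\mathrm{Trace}_g R^N(d\phi,\tau(\phi))d\phi,$$ $$\tau_{2,f}(\phi)=f\,\tau_2(\phi)+(\Delta f)\,\tau(\phi)+2\nabla^\phi_{\mathrm{grad} f}\tau(\phi),$$ where $\nabla^\phi$ is the pull-back of the Levi-Civita connection of $N$, $R^N(X,Y)Z=[\nabla^N_X,\nabla^N_Y]Z-\nabla^N_{[X,Y]}Z$, and $\Delta f$ is the trace of the Hessian of $f$. The hypersurface is $f$-biharmonic if $\tau_{2,f}(\phi)=0$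 on $M$ for some smooth $f:M\to(0,\infty)$. It is totally umbilical if its second fundamental form $B=\nabla d\phi$ satisfies $B(X,Y)=g(X,Y)\,\eta$, where $\eta=\frac1m\mathrm{Trace}_g B$ is the mean curvature vector, and totally geodesic if $B=0$. Suppose that $\phi$ is totally umbilical and $f$-biharmonic. 1. If $N=\mathbb{R}^{m+1}$ or $N=H^{m+1}$, then $\phi$ is totally geodesic. 2. If $N=S^{m+1}$ and $M$ is connected, then, up to an isometry of $S^{m+1}$ (the restriction of an orthogonal transformation of $\mathbb{R}^{m+2}$), the image $\phi(M)$ is a part (a relatively open subset) of the great sphere $S^m=\{x\in S^{m+1}: x_1=0\}$ or of the small sphere $S^m(1/\sqrt2)=\{(1/\sqrt2,x)\in\mathbb{R}\times\mathbb{R}^{m+1}: |x|=1/\sqrt2\}$. -/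

import Mathlib

open scoped Manifold ContDiff

/-- The Euclidean space `ℝⁿ`. -/
abbrev Euc (n : ℕ) : Type := EuclideanSpace ℝ (Fin n)

namespace FBiharm

noncomputable section

/-! ### Riemannian geometry in coordinates

Coordinates run through (open parts of) `ℝⁿ`.  A metric in coordinates is written
`G : Euc n → Euc n → Euc n → ℝ`, where `G x u v` is the inner product of the tangent vectors
`u, v` at the point `x`. -/

/-- The `i`-th coordinate vector field `∂_i`. -/
def bvec {n : ℕ} (i : Fin n) : Euc n := EuclideanSpace.single i 1

/-- The matrix `g^{ij}(x)`, inverse of `g_{ij}(x) = G x ∂_i ∂_j`. -/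
def invGram {n : ℕ} (G : Euc n → Euc n → Euc n → ℝ) (x : Euc n) : Matrix (Fin n) (Fin n) ℝ :=
  (Matrix.of fun i j => G x (bvec i) (bvec j))⁻¹

/-- The Christoffel symbols of the Levi-Civita connection, as a vector valued bilinear form:
`Γ(u, v) = ½ g^{kl} (∂_u g(v, ∂_l) + ∂_v g(u, ∂_l) - ∂_l g(u, v)) ∂_k`. For vector fields
`u, v` with constant coefficients, `∇_u v = Γ(u, v)`. -/
def christoffel {n : ℕ} (G : Euc n → Euc n → Euc n → ℝ) (x u v : Euc n) : Euc n :=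
  ∑ k, ∑ l, (invGram G x k l * ((1 / 2) *
    (fderiv ℝ (fun y => G y v (bvec l)) x u + fderiv ℝ (fun y => G y u (bvec l)) x v
      - fderiv ℝ (fun y => G y u v) x (bvec l)))) • bvec k

/-- The curvature `R(u, v)w = ∇_u ∇_v w - ∇_v ∇_u w - ∇_{[u,v]} w`, evaluated on vector fields with
constant coefficients (so that `[u, v] = 0` and `∇_v w = Γ(v, w)`). -/
def curvature {n : ℕ} (G : Euc n → Euc n → Euc n → ℝ) (x u v w : Euc n) : Euc n :=
  (fderiv ℝ (fun y => christoffel G y v w) x u + christoffel G x u (christoffel G x v w))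
    - (fderiv ℝ (fun y => christoffel G y u w) x v + christoffel G x v (christoffel G x u w))

/-- The trace `g^{ij} B(∂_i, ∂_j)` of a bilinear form at the point `x`. -/
def traceG {n : ℕ} {F : Type*} [AddCommGroup F] [Module ℝ F] (G : Euc n → Euc n → Euc n → ℝ)
    (x : Euc n) (B : Euc n → Euc n → F) : F :=
  ∑ i, ∑ j, invGram G x i j • B (bvec i) (bvec j)

/-- The gradient of a function, `g^{ij} (∂_j f) ∂_i`. -/
def gradG {n : ℕ} (G : Euc n → Euc n → Euc n → ℝ) (f : Euc n → ℝ) (x : Euc n) : Euc n :=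
  ∑ i, ∑ j, (invGram G x i j * fderiv ℝ f x (bvec j)) • bvec i

/-- The Laplace-Beltrami operator, the trace of the Hessian:
`Δ f = g^{ij} (∂_i ∂_j f - Γ^k_{ij} ∂_k f)`. -/
def laplaceG {n : ℕ} (G : Euc n → Euc n → Euc n → ℝ) (f : Euc n → ℝ) (x : Euc n) : ℝ :=
  traceG G x fun u v => fderiv ℝ (fun y => fderiv ℝ f y v) x u - fderiv ℝ f x (christoffel G x u v)

/-- The pull-back connection `∇^φ` on vector fields along the map `φ` (into a space with the
metric `H`): `(∇^φ_u V)(x) = ∂_u V + Γ^H(dφ(u), V)`. -/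
def covAlong {n k : ℕ} (H : Euc k → Euc k → Euc k → ℝ) (φ : Euc n → Euc k) (V : Euc n → Euc k)
    (x u : Euc n) : Euc k :=
  fderiv ℝ V x u + christoffel H (φ x) (fderiv ℝ φ x u) (V x)

/-- The second fundamental form `(∇ dφ)(u, v) = ∇^φ_u (dφ(v)) - dφ(∇_u v)` of a map. -/
def secondFF {n k : ℕ} (G : Euc n → Euc n → Euc n → ℝ) (H : Euc k → Euc k → Euc k → ℝ)
    (φ : Euc n → Euc k) (x u v : Euc n) : Euc k :=
  covAlong H φ (fun y => fderiv ℝ φ y v) x u - fderiv ℝ φ x (christoffel G x u v)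

/-- The tension field `τ(φ) = Trace_g ∇ dφ`. -/
def tension {n k : ℕ} (G : Euc n → Euc n → Euc n → ℝ) (H : Euc k → Euc k → Euc k → ℝ)
    (φ : Euc n → Euc k) (x : Euc n) : Euc k :=
  traceG G x (secondFF G H φ x)

/-- The bitension field
`τ₂(φ) = Trace_g (∇^φ ∇^φ - ∇^φ_{∇^M}) τ(φ) - Trace_g R^N(dφ, τ(φ)) dφ`. -/
def bitension {n k : ℕ} (G : Euc n → Euc n → Euc n → ℝ) (H : Euc k → Euc k → Euc k → ℝ)
    (φ : Euc n → Euc k) (x : Euc n) : Euc k :=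
  traceG G x (fun u v =>
      covAlong H φ (fun y => covAlong H φ (tension G H φ) y v) x u
        - covAlong H φ (tension G H φ) x (christoffel G x u v))
    - traceG G x (fun u v =>
      curvature H (φ x) (fderiv ℝ φ x u) (tension G H φ x) (fderiv ℝ φ x v))

/-- The `f`-bitension field `τ_{2,f}(φ) = f τ₂(φ) + (Δ f) τ(φ) + 2 ∇^φ_{grad f} τ(φ)`. -/
def fBitension {n k : ℕ} (G : Euc n → Euc n → Euc n → ℝ) (H : Euc k → Euc k → Euc k → ℝ)
    (φ : Euc n → Euc k) (f : Euc n → ℝ) (x : Euc n) : Euc k :=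
  f x • bitension G H φ x + laplaceG G f x • tension G H φ x
    + (2 : ℝ) • covAlong H φ (tension G H φ) x (gradG G f x)

/-! ### Maps between Riemannian manifolds -/

/-- A family of bilinear forms on the tangent spaces of an `n`-dimensional manifold. -/
abbrev MetricTensor (n : ℕ) (N : Type*) [TopologicalSpace N] [ChartedSpace (Euc n) N] :=
  ∀ x : N, TangentSpace (𝓡 n) x → TangentSpace (𝓡 n) x → ℝ

/-- The metric tensor of a smooth Riemannian metric. -/
def metricOf {n : ℕ} {N : Type*} [TopologicalSpace N] [ChartedSpace (Euc n) N]
    [IsManifold (𝓡 n) ∞ N]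
    (g : Bundle.ContMDiffRiemannianMetric (𝓡 n) ∞ (Euc n) (fun x : N => TangentSpace (𝓡 n) x)) :
    MetricTensor n N :=
  fun x u v => g.inner x u v

/-- The expression of a metric tensor in a chart `e`:
`(u, v) ↦ h(d(e⁻¹)_y u, d(e⁻¹)_y v)` at the point `y` of the target of `e`. -/
def metricInChart {n : ℕ} {N : Type*} [TopologicalSpace N] [ChartedSpace (Euc n) N]
    (h : MetricTensor n N) (e : OpenPartialHomeomorph N (Euc n)) : Euc n → Euc n → Euc n → ℝ :=
  fun y u v => h (e.symm y) (mfderiv (𝓡 n) (𝓡 n) e.symm y u) (mfderiv (𝓡 n) (𝓡 n) e.symm y v)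

section Maps

variable {m n : ℕ} {M N : Type*} [TopologicalSpace M] [ChartedSpace (Euc m) M]
  [TopologicalSpace N] [ChartedSpace (Euc n) N]

/-- A smooth map `φ : (M, g) → (N, h)` with `φ^* h = g`. -/
def IsIsometricImmersion (g : MetricTensor m M) (h : MetricTensor n N) (φ : M → N) : Prop :=
  ContMDiff (𝓡 m) (𝓡 n) ∞ φ ∧
    ∀ (p : M) (u v : TangentSpace (𝓡 m) p),
      h (φ p) (mfderiv (𝓡 m) (𝓡 n) φ p u) (mfderiv (𝓡 m) (𝓡 n) φ p v) = g p u v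

/-- `φ : (M, g) → (N, h)` satisfies the `f`-biharmonic map equation `τ_{2,f}(φ) = 0`: the
equation holds at every point, in all pairs of charts of `M` and `N`. -/
def IsFBiharmonicMap (g : MetricTensor m M) (h : MetricTensor n N) (φ : M → N) (f : M → ℝ) :
    Prop :=
  ∀ e ∈ atlas (Euc m) M, ∀ e' ∈ atlas (Euc n) N, ∀ p ∈ e.source, φ p ∈ e'.source →
    fBitension (metricInChart g e) (metricInChart h e') (e' ∘ φ ∘ e.symm) (f ∘ e.symm) (e p) = 0

/-- `φ : (M, g) → (N, h)` is `f`-biharmonic for some smooth positive function `f` on `M`. -/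
def IsFBiharmonic (g : MetricTensor m M) (h : MetricTensor n N) (φ : M → N) : Prop :=
  ∃ f : M → ℝ, ContMDiff (𝓡 m) 𝓘(ℝ, ℝ) ∞ f ∧ (∀ p, 0 < f p) ∧ IsFBiharmonicMap g h φ f

/-- Total umbilicity of an isometric immersion: the second fundamental form is
`B(u, v) = g(u, v) η`, where `η = (1/m) Trace_g B` is the mean curvature vector
(equivalently `A(X) = H X` for a hypersurface with unit normal `ξ` and `η = H ξ`). -/
def IsTotallyUmbilical (g : MetricTensor m M) (h : MetricTensor n N) (φ : M → N) : Prop :=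
  ∀ e ∈ atlas (Euc m) M, ∀ e' ∈ atlas (Euc n) N, ∀ p ∈ e.source, φ p ∈ e'.source →
    ∀ u v : Euc m,
      secondFF (metricInChart g e) (metricInChart h e') (e' ∘ φ ∘ e.symm) (e p) u v =
        metricInChart g e (e p) u v • ((1 / (m : ℝ)) •
          tension (metricInChart g e) (metricInChart h e') (e' ∘ φ ∘ e.symm) (e p))

/-- An isometric immersion is totally geodesic if its second fundamental form vanishes. -/
def IsTotallyGeodesic (g : MetricTensor m M) (h : MetricTensor n N) (φ : M → N) : Prop :=
  ∀ e ∈ atlas (Euc m) M, ∀ e' ∈ atlas (Euc n) N, ∀ p ∈ e.source, φ p ∈ e'.source →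
    ∀ u v : Euc m,
      secondFF (metricInChart g e) (metricInChart h e') (e' ∘ φ ∘ e.symm) (e p) u v = 0

end Maps

/-! ### The space forms -/

/-- The flat metric of `ℝⁿ`. -/
def euclideanMetric (n : ℕ) : MetricTensor n (Euc n) :=
  fun _ u v => inner ℝ (show Euc n from u) (show Euc n from v)

/-- The unit sphere `S^n ⊆ ℝ^{n+1}`. -/
abbrev UnitSphere (n : ℕ) : Type := Metric.sphere (0 : Euc (n + 1)) 1

/-- The round metric of `S^n`, induced by the inclusion into `ℝ^{n+1}`. -/
def sphereMetric (n : ℕ) : MetricTensor n (UnitSphere n) :=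
  fun x u v => euclideanMetric (n + 1) (x : Euc (n + 1))
    (mfderiv (𝓡 n) (𝓡 (n + 1)) (Subtype.val : UnitSphere n → Euc (n + 1)) x u)
    (mfderiv (𝓡 n) (𝓡 (n + 1)) (Subtype.val : UnitSphere n → Euc (n + 1)) x v)

/-- The open unit ball of `ℝⁿ`. -/
def unitBall (n : ℕ) : TopologicalSpace.Opens (Euc n) := ⟨Metric.ball 0 1, Metric.isOpen_ball⟩

/-- Hyperbolic space `H^n`, in the Poincaré ball model. -/
abbrev HypSpace (n : ℕ) : Type := unitBall n

/-- The Poincaré metric `4 |dx|² / (1 - |x|²)²`, of constant sectional curvature `-1`. -/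
def hyperbolicMetric (n : ℕ) : MetricTensor n (HypSpace n) :=
  fun x u v => 4 / (1 - ‖(x : Euc n)‖ ^ 2) ^ 2 * euclideanMetric n (x : Euc n)
    (mfderiv (𝓡 n) (𝓡 n) (Subtype.val : HypSpace n → Euc n) x u)
    (mfderiv (𝓡 n) (𝓡 n) (Subtype.val : HypSpace n → Euc n) x v)

/-- The great sphere `S^m ⊆ S^{m+1}`: the unit vectors with first coordinate `0`. -/
def greatSphere (m : ℕ) : Set (UnitSphere (m + 1)) := {x | (x : Euc (m + 1 + 1)) 0 = 0}

/-- The small sphere `S^m(1/√2) ⊆ S^{m+1}`: the points `(1/√2, x)` of `S^{m+1}`; then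
`|x| = 1/√2`. -/
def smallSphere (m : ℕ) : Set (UnitSphere (m + 1)) :=
  {x | (x : Euc (m + 1 + 1)) 0 = 1 / Real.sqrt 2}

/-- Up to an isometry of `S^{m+1}` (the restriction of an orthogonal map `Ψ` of `ℝ^{m+2}`), the
image of `φ` is a part, that is, a relatively open subset, of `S`. -/
def IsPartOfUpToIsometry {m : ℕ} {M : Type*} (φ : M → UnitSphere (m + 1))
    (S : Set (UnitSphere (m + 1))) : Prop :=
  ∃ Ψ : Euc (m + 1 + 1) ≃ₗᵢ[ℝ] Euc (m + 1 + 1), ∃ W : Set (UnitSphere (m + 1)), IsOpen W ∧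
    {y : UnitSphere (m + 1) | ∃ p, (y : Euc (m + 1 + 1)) = Ψ (φ p)} = W ∩ S

end

end FBiharm

/-!
In every chart of a space form the metric is conformally flat, `F⁻² ⟨·, ·⟩` with
`F y = α + β |y|²`, of constant curvature `4αβ`, so that the covariant derivative along an
immersion has a closed form and no Christoffel symbol of the target has to be computed.

If `B = g η`, the Codazzi equation makes `η` parallel in the normal bundle, since `m ≥ 2`: thus
`∇_w η = -|η|² dφ(w)`, and `|η|` is locally constant. The tension field is `m η`, and the normal
and tangential parts of `τ_{2,f} = 0` are `(m f (4αβ - |η|²) + Δf) η = 0` and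
`|η|² dφ(grad f) = 0`. Where `η ≠ 0`, the function `f` is therefore locally constant and
`|η|² = 4αβ`, which excludes curvature `≤ 0`.

On the sphere, `η = c N` locally, with `c ∈ {0, 1}` and `N` a unit normal field. With `σ` the
inclusion into `ℝ^{m+2}`, the vector `C = dσ(N) + c σ` is locally constant and `⟪σ ∘ φ, C⟫ = c`.
The pair `(C, c)` is determined up to sign by any piece of the hypersurface, so on a connected `M`
one pair serves everywhere, and the inverse function theorem makes the image relatively open.
-/

namespace FBiharm

open Filter Topology RealInnerProductSpace ContinuousLinearMap

section Calculus

variable {X F : Type*} [NormedAddCommGroup X] [NormedSpace ℝ X] [NormedAddCommGroup F]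
  [NormedSpace ℝ F] {f : X → F} {x : X}

lemma differentiableAt_fderiv_apply (hf : ContDiffAt ℝ 2 f x) (u : X) :
    DifferentiableAt ℝ (fun y => fderiv ℝ f y u) x :=
  ((hf.fderiv_right (m := 1) (by norm_num)).differentiableAt (by norm_num)).clm_apply
    (differentiableAt_const u)

lemma fderiv_fderiv_apply_comm (hf : ContDiffAt ℝ 2 f x) (u w : X) :
    fderiv ℝ (fun y => fderiv ℝ f y u) x w = fderiv ℝ (fun y => fderiv ℝ f y w) x u := by
  have hdf := (hf.fderiv_right (m := 1) (by norm_num)).differentiableAt (by norm_num)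
  have hsymm := hf.isSymmSndFDerivAt (by simp) w u
  simpa [fderiv_clm_apply hdf] using hsymm

lemma eventually_eq_of_fderiv_eq_zero
    (h : ∀ᶠ y in 𝓝 x, DifferentiableAt ℝ f y ∧ fderiv ℝ f y = 0) : ∀ᶠ y in 𝓝 x, f y = f x := by
  obtain ⟨ε, hε, hb⟩ := Metric.eventually_nhds_iff_ball.1 h
  obtain ⟨a, ha⟩ := Metric.isOpen_ball.exists_is_const_of_fderiv_eq_zero
    (convex_ball x ε).isPreconnected (fun y hy => (hb y hy).1.differentiableWithinAt)
    (fun y hy => (hb y hy).2)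
  filter_upwards [Metric.ball_mem_nhds x hε] with y hy
  rw [ha y hy, ha x (Metric.mem_ball_self hε)]

end Calculus

/-! ### Conformally flat metrics of constant curvature -/

section Conformal

variable {X E : Type*} [NormedAddCommGroup X] [NormedSpace ℝ X] [NormedAddCommGroup E]
  [InnerProductSpace ℝ E]

/-- The function `F(y) = α + β |y|²`; the models of the space forms are the metrics
`F⁻² ⟨·, ·⟩`. -/
def confFactor (α β : ℝ) (y : E) : ℝ := α + β * ⟪y, y⟫

/-- The metric `F⁻² ⟨·, ·⟩` of constant sectional curvature `4 α β`, where `F = confFactor α β`. -/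
noncomputable def confMetric (α β : ℝ) (y : E) : LinearMap.BilinForm ℝ E :=
  (confFactor α β y ^ 2)⁻¹ • innerₗ E

/-- The Levi-Civita connection `∇_u v` of `F⁻² ⟨·, ·⟩` on constant vector fields. -/
noncomputable def confChristoffel (α β : ℝ) (y u v : E) : E :=
  (-(2 * β) * (confFactor α β y)⁻¹) • (⟪y, u⟫ • v + ⟪y, v⟫ • u - ⟪u, v⟫ • y)

/-- The covariant derivative `∇_u V`, at the point `x`, of a vector field `V` along the map `ψ` into
the metric `F⁻² ⟨·, ·⟩`. -/
noncomputable def confCov (α β : ℝ) (ψ V : X → E) (x u : X) : E :=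
  fderiv ℝ V x u + confChristoffel α β (ψ x) (fderiv ℝ ψ x u) (V x)

variable {α β : ℝ} {ψ V W : X → E} {x : X}

lemma confMetric_apply (y u v : E) :
    confMetric α β y u v = (confFactor α β y ^ 2)⁻¹ * ⟪u, v⟫ := rfl

lemma confMetric_comm (y u v : E) : confMetric α β y u v = confMetric α β y v u := by
  rw [confMetric_apply, confMetric_apply, real_inner_comm]

lemma confMetric_self_nonneg (y u : E) : 0 ≤ confMetric α β y u u := by
  rw [confMetric_apply]
  exact mul_nonneg (by positivity) real_inner_self_nonneg

lemma confMetric_self_eq_zero {y u : E} (hF : confFactor α β y ≠ 0) :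
    confMetric α β y u u = 0 ↔ u = 0 := by
  simp [confMetric_apply, hF]

lemma confChristoffel_comm (y u v : E) :
    confChristoffel α β y u v = confChristoffel α β y v u := by
  simp only [confChristoffel, real_inner_comm u v]
  module

@[fun_prop]
lemma continuous_confFactor : Continuous fun y : E => confFactor α β y := by
  unfold confFactor
  fun_prop

lemma hasFDerivAt_confFactor (hψ : DifferentiableAt ℝ ψ x) :
    HasFDerivAt (fun y => confFactor α β (ψ y))
      ((2 * β) • (innerSL ℝ (ψ x)).comp (fderiv ℝ ψ x)) x := by
  refine (((hψ.hasFDerivAt.inner ℝ hψ.hasFDerivAt).const_mul β).const_add α).congr_fderiv ?_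
  ext u
  simp [fderivInnerCLM_apply, real_inner_comm (ψ x)]
  ring

lemma hasFDerivAt_inv_confFactor (hψ : DifferentiableAt ℝ ψ x) (hF : confFactor α β (ψ x) ≠ 0) :
    HasFDerivAt (fun y => (confFactor α β (ψ y))⁻¹)
      ((-(confFactor α β (ψ x) ^ 2)⁻¹ * (2 * β)) • (innerSL ℝ (ψ x)).comp (fderiv ℝ ψ x)) x := by
  refine ((hasDerivAt_inv hF).comp_hasFDerivAt x (hasFDerivAt_confFactor hψ)).congr_fderiv ?_
  rw [smul_smul]

lemma differentiableAt_confMetric (hψ : DifferentiableAt ℝ ψ x) (hV : DifferentiableAt ℝ V x)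
    (hW : DifferentiableAt ℝ W x) (hF : confFactor α β (ψ x) ≠ 0) :
    DifferentiableAt ℝ (fun y => confMetric α β (ψ y) (V y) (W y)) x := by
  simp only [confMetric_apply, ← inv_pow]
  exact ((hasFDerivAt_inv_confFactor hψ hF).differentiableAt.pow 2).mul (hV.inner ℝ hW)

lemma fderiv_confMetric (hψ : DifferentiableAt ℝ ψ x) (hV : DifferentiableAt ℝ V x)
    (hW : DifferentiableAt ℝ W x) (hF : confFactor α β (ψ x) ≠ 0) (u : X) :
    fderiv ℝ (fun y => confMetric α β (ψ y) (V y) (W y)) x u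
      = confMetric α β (ψ x) (confCov α β ψ V x u) (W x)
        + confMetric α β (ψ x) (V x) (confCov α β ψ W x u) := by
  have h := ((hasFDerivAt_inv_confFactor hψ hF).pow 2).mul
    (hV.hasFDerivAt.inner ℝ hW.hasFDerivAt)
  simp only [confMetric_apply, ← inv_pow]
  refine (DFunLike.congr_fun h.fderiv u).trans ?_
  simp only [add_apply, FunLike.coe_smul, coe_comp, Pi.smul_apply, Function.comp_apply, prod_apply,
    fderivInnerCLM_apply, coe_innerSL_apply, smul_eq_mul, nsmul_eq_mul,
    Nat.add_one_sub_one, pow_one, confCov, confChristoffel, inner_add_left, inner_add_right,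
    inner_smul_left, inner_smul_right, inner_sub_left, inner_sub_right, RCLike.conj_to_real,
    real_inner_comm (V x) (ψ x), real_inner_comm (fderiv ℝ ψ x u) (V x)]
  field_simp
  ring

lemma differentiableAt_confChristoffel (hψ : DifferentiableAt ℝ ψ x)
    (hV : DifferentiableAt ℝ V x) (hW : DifferentiableAt ℝ W x)
    (hF : confFactor α β (ψ x) ≠ 0) :
    DifferentiableAt ℝ (fun y => confChristoffel α β (ψ y) (V y) (W y)) x :=
  ((hasFDerivAt_inv_confFactor hψ hF).differentiableAt.const_mul _).smul
    ((((hψ.inner ℝ hV).smul hW).add ((hψ.inner ℝ hW).smul hV)).sub ((hV.inner ℝ hW).smul hψ))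

lemma fderiv_confChristoffel (hψ : DifferentiableAt ℝ ψ x) (hV : DifferentiableAt ℝ V x)
    (hW : DifferentiableAt ℝ W x) (hF : confFactor α β (ψ x) ≠ 0) (u : X) :
    fderiv ℝ (fun y => confChristoffel α β (ψ y) (V y) (W y)) x u
      = confChristoffel α β (ψ x) (fderiv ℝ V x u) (W x)
        + confChristoffel α β (ψ x) (V x) (fderiv ℝ W x u)
        + (4 * β ^ 2 * ⟪ψ x, fderiv ℝ ψ x u⟫ * (confFactor α β (ψ x) ^ 2)⁻¹) •
          (⟪ψ x, V x⟫ • W x + ⟪ψ x, W x⟫ • V x - ⟪V x, W x⟫ • ψ x)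
        + (-(2 * β) * (confFactor α β (ψ x))⁻¹) •
          (⟪fderiv ℝ ψ x u, V x⟫ • W x + ⟪fderiv ℝ ψ x u, W x⟫ • V x
            - ⟪V x, W x⟫ • fderiv ℝ ψ x u) := by
  have hψ' := hψ.hasFDerivAt
  have hV' := hV.hasFDerivAt
  have hW' := hW.hasFDerivAt
  have h := ((hasFDerivAt_inv_confFactor hψ hF).const_mul (-(2 * β))).smul
    ((((hψ'.inner ℝ hV').smul hW').add ((hψ'.inner ℝ hW').smul hV')).sub
      ((hV'.inner ℝ hW').smul hψ'))
  refine (DFunLike.congr_fun h.fderiv u).trans ?_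
  simp only [confChristoffel, add_apply, sub_apply, FunLike.coe_smul, coe_comp, smulRight_apply,
    Pi.smul_apply, Pi.add_apply, Pi.sub_apply, Pi.smul_apply', Function.comp_apply, prod_apply,
    fderivInnerCLM_apply, coe_innerSL_apply, smul_eq_mul]
  match_scalars <;> field_simp <;> ring

lemma differentiableAt_confCov (hψ : ContDiffAt ℝ 2 ψ x) (hV : ContDiffAt ℝ 2 V x)
    (hF : confFactor α β (ψ x) ≠ 0) (u : X) :
    DifferentiableAt ℝ (fun y => confCov α β ψ V y u) x :=
  (differentiableAt_fderiv_apply hV u).add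
    (differentiableAt_confChristoffel (hψ.differentiableAt (by norm_num))
      (differentiableAt_fderiv_apply hψ u) (hV.differentiableAt (by norm_num)) hF)

lemma confCov_confCov (hψ : ContDiffAt ℝ 2 ψ x) (hV : ContDiffAt ℝ 2 V x)
    (hF : confFactor α β (ψ x) ≠ 0) (u w : X) :
    confCov α β ψ (fun y => confCov α β ψ V y u) x w
      = fderiv ℝ (fun y => fderiv ℝ V y u) x w
        + fderiv ℝ (fun y => confChristoffel α β (ψ y) (fderiv ℝ ψ y u) (V y)) x w
        + confChristoffel α β (ψ x) (fderiv ℝ ψ x w) (confCov α β ψ V x u) := by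
  refine congrArg (· + _) (DFunLike.congr_fun (fderiv_fun_add (differentiableAt_fderiv_apply hV u)
    (differentiableAt_confChristoffel ?_ (differentiableAt_fderiv_apply hψ u) ?_ hF)) w)
  exacts [hψ.differentiableAt (by norm_num), hV.differentiableAt (by norm_num)]

lemma confCov_fderiv_comm (hψ : ContDiffAt ℝ 2 ψ x) (u w : X) :
    confCov α β ψ (fun y => fderiv ℝ ψ y u) x w
      = confCov α β ψ (fun y => fderiv ℝ ψ y w) x u := by
  rw [confCov, confCov, fderiv_fderiv_apply_comm hψ, confChristoffel_comm]

/-- The Ricci identity: in constant curvature `K`, `R(X, Y)V = K (⟨Y, V⟩ X - ⟨X, V⟩ Y)`. -/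
lemma confCov_confCov_sub (hψ : ContDiffAt ℝ 2 ψ x) (hV : ContDiffAt ℝ 2 V x)
    (hF : confFactor α β (ψ x) ≠ 0) (u w : X) :
    confCov α β ψ (fun y => confCov α β ψ V y u) x w
        - confCov α β ψ (fun y => confCov α β ψ V y w) x u
      = (4 * α * β) • (confMetric α β (ψ x) (fderiv ℝ ψ x u) (V x) • fderiv ℝ ψ x w
        - confMetric α β (ψ x) (fderiv ℝ ψ x w) (V x) • fderiv ℝ ψ x u) := by
  have hdψ := hψ.differentiableAt (by norm_num)
  have hdV := hV.differentiableAt (by norm_num)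
  have hα : α = confFactor α β (ψ x) - β * ⟪ψ x, ψ x⟫ := by simp [confFactor]
  rw [confCov_confCov hψ hV hF, confCov_confCov hψ hV hF,
    fderiv_confChristoffel hdψ (differentiableAt_fderiv_apply hψ u) hdV hF,
    fderiv_confChristoffel hdψ (differentiableAt_fderiv_apply hψ w) hdV hF,
    fderiv_fderiv_apply_comm hψ u w, fderiv_fderiv_apply_comm hV u w]
  simp only [confCov, confMetric_apply, confChristoffel, inner_add_right, inner_smul_right,
    inner_sub_right]
  rw [real_inner_comm (ψ x) (fderiv ℝ ψ x u), real_inner_comm (ψ x) (fderiv ℝ ψ x w),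
    real_inner_comm (fderiv ℝ ψ x u) (fderiv ℝ ψ x w)]
  generalize confFactor α β (ψ x) = F at hF hα
  subst hα
  match_scalars <;> field_simp <;> ring

end Conformal

/-! ### The Levi-Civita connection in coordinates -/

section Coordinates

variable {n : ℕ} {G : Euc n → Euc n → Euc n → ℝ} {x : Euc n}

lemma coe_basisFun_eq_bvec : ⇑(EuclideanSpace.basisFun (Fin n) ℝ).toBasis = bvec := by
  ext1 i
  simp [bvec]

lemma linearMap_ext_bvec {F : Type*} [AddCommGroup F] [Module ℝ F] {f g : Euc n →ₗ[ℝ] F}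
    (h : ∀ i, f (bvec i) = g (bvec i)) : f = g :=
  (EuclideanSpace.basisFun (Fin n) ℝ).toBasis.ext fun i => by
    rw [coe_basisFun_eq_bvec, h]

/-- The family `G` of functions of two vectors is given at `x` by the nondegenerate symmetric
bilinear form `B`, that is, it is a pseudo-Riemannian metric at that point. -/
structure IsMetricAt (G : Euc n → Euc n → Euc n → ℝ) (x : Euc n)
    (B : LinearMap.BilinForm ℝ (Euc n)) : Prop where
  apply : ∀ u v, G x u v = B u v
  symm : ∀ u v, B u v = B v u
  nondegenerate : B.Nondegenerate

/-- The vectors `g^{ij} ∂_i`, dual to the coordinate vectors `∂_j` with respect to `G x`. -/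
noncomputable def dualFrame (G : Euc n → Euc n → Euc n → ℝ) (x : Euc n) (j : Fin n) : Euc n :=
  ∑ i, invGram G x i j • bvec i

lemma christoffel_eq_sum_dualFrame (u v : Euc n) :
    christoffel G x u v = ∑ j, ((1 / 2) * (fderiv ℝ (fun y => G y v (bvec j)) x u
      + fderiv ℝ (fun y => G y u (bvec j)) x v - fderiv ℝ (fun y => G y u v) x (bvec j)))
        • dualFrame G x j := by
  simp only [christoffel, dualFrame, Finset.smul_sum, smul_smul]
  rw [Finset.sum_comm]
  simp only [mul_comm]

lemma gradG_eq_sum_dualFrame (f : Euc n → ℝ) :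
    gradG G f x = ∑ j, fderiv ℝ f x (bvec j) • dualFrame G x j := by
  simp only [gradG, dualFrame, Finset.smul_sum, smul_smul]
  rw [Finset.sum_comm]
  simp only [mul_comm]

lemma laplaceG_eq_zero_of_eventually_fderiv_eq_zero {f : Euc n → ℝ}
    (hf : ∀ᶠ y in 𝓝 x, fderiv ℝ f y = 0) : laplaceG G f x = 0 := by
  have hhess : ∀ v, fderiv ℝ (fun y => fderiv ℝ f y v) x = 0 := fun v => by
    rw [EventuallyEq.fderiv_eq (f := fun _ => (0 : ℝ)) (hf.mono fun y hy => by simp [hy])]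
    exact fderiv_const_apply _
  simp [laplaceG, traceG, hhess, hf.self_of_nhds]

namespace IsMetricAt

variable {B : LinearMap.BilinForm ℝ (Euc n)}

lemma of_definite (happly : ∀ u v, G x u v = B u v) (hsymm : ∀ u v, B u v = B v u)
    (hdef : ∀ u, B u u = 0 → u = 0) : IsMetricAt G x B where
  apply := happly
  symm := hsymm
  nondegenerate := ⟨fun u hu => hdef u (hu u), fun u hu => hdef u (hu u)⟩

lemma det_gram_ne_zero (hB : IsMetricAt G x B) :
    (Matrix.of fun i j => G x (bvec i) (bvec j)).det ≠ 0 := by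
  have hgram : (Matrix.of fun i j => G x (bvec i) (bvec j))
      = LinearMap.BilinForm.toMatrix (EuclideanSpace.basisFun (Fin n) ℝ).toBasis B := by
    ext i j
    rw [Matrix.of_apply, LinearMap.BilinForm.toMatrix_apply, coe_basisFun_eq_bvec, hB.apply]
  rw [hgram]
  exact (LinearMap.BilinForm.nondegenerate_iff_det_ne_zero _).1 hB.nondegenerate

lemma apply_dualFrame_bvec (hB : IsMetricAt G x B) (i j : Fin n) :
    B (dualFrame G x i) (bvec j) = if i = j then 1 else 0 := by
  have hinv := congrFun (congrFun
    (Matrix.mul_nonsing_inv _ (isUnit_iff_ne_zero.2 hB.det_gram_ne_zero)) j) i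
  rw [Matrix.mul_apply] at hinv
  rw [dualFrame, map_sum, LinearMap.sum_apply]
  simp only [map_smul, LinearMap.smul_apply, smul_eq_mul, eq_comm (a := i),
    ← Matrix.one_apply, ← hinv]
  refine Finset.sum_congr rfl fun l _ => ?_
  rw [hB.symm, ← hB.apply, mul_comm]
  rfl

lemma apply_sum_dualFrame_bvec (hB : IsMetricAt G x B) (c : Fin n → ℝ) (j : Fin n) :
    B (∑ i, c i • dualFrame G x i) (bvec j) = c j := by
  simp [LinearMap.sum_apply, hB.apply_dualFrame_bvec]

lemma koszul (hB : IsMetricAt G x B) (u v : Euc n) (j : Fin n) :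
    B (christoffel G x u v) (bvec j) = (1 / 2) * (fderiv ℝ (fun y => G y v (bvec j)) x u
      + fderiv ℝ (fun y => G y u (bvec j)) x v - fderiv ℝ (fun y => G y u v) x (bvec j)) := by
  rw [christoffel_eq_sum_dualFrame, hB.apply_sum_dualFrame_bvec]

lemma fderiv_eq_zero_of_gradG_eq_zero (hB : IsMetricAt G x B) {f : Euc n → ℝ}
    (hf : gradG G f x = 0) : fderiv ℝ f x = 0 := by
  refine ContinuousLinearMap.coe_injective (linearMap_ext_bvec fun j => ?_)
  have hj := hB.apply_sum_dualFrame_bvec (fun j => fderiv ℝ f x (bvec j)) j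
  rw [← gradG_eq_sum_dualFrame, hf] at hj
  simpa using hj.symm

lemma traceG_smul_const (hB : IsMetricAt G x B) {F : Type*} [AddCommGroup F] [Module ℝ F]
    (a : F) : traceG G x (fun u v => G x u v • a) = (n : ℝ) • a := by
  have htrace : ∀ j, ∑ i, invGram G x i j * G x (bvec i) (bvec j) = 1 := fun j => by
    simpa [dualFrame, LinearMap.sum_apply, hB.apply] using hB.apply_dualFrame_bvec j j
  simp only [traceG, smul_smul, ← Finset.sum_smul]
  rw [Finset.sum_comm]
  simp [htrace]

end IsMetricAt

end Coordinates

section Pullback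

variable {n : ℕ} {E : Type*} [NormedAddCommGroup E] [InnerProductSpace ℝ E] {α β : ℝ}
  {ψ : Euc n → E} {G : Euc n → Euc n → Euc n → ℝ} {x : Euc n}

lemma isMetricAt_pullback (hF : confFactor α β (ψ x) ≠ 0)
    (hinj : Function.Injective (fderiv ℝ ψ x))
    (hG : ∀ u v, G x u v = confMetric α β (ψ x) (fderiv ℝ ψ x u) (fderiv ℝ ψ x v)) :
    IsMetricAt G x ((confMetric α β (ψ x)).comp (fderiv ℝ ψ x).toLinearMap
      (fderiv ℝ ψ x).toLinearMap) :=
  .of_definite (fun u v => by simp only [LinearMap.BilinForm.comp_apply, coe_coe, hG])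
    (fun u v => by simp only [LinearMap.BilinForm.comp_apply, confMetric_comm])
    fun u hu => by
      rw [LinearMap.BilinForm.comp_apply, confMetric_self_eq_zero hF, coe_coe] at hu
      exact hinj (hu.trans (map_zero _).symm)

/-- The Levi-Civita connection of a metric induced from `F⁻² ⟨·, ·⟩` is the tangential part of the
ambient connection. -/
lemma confMetric_fderiv_christoffel (hψ : ContDiffAt ℝ 2 ψ x) (hF : confFactor α β (ψ x) ≠ 0)
    (hinj : Function.Injective (fderiv ℝ ψ x))
    (hG : ∀ᶠ y in 𝓝 x, ∀ u v,
      G y u v = confMetric α β (ψ y) (fderiv ℝ ψ y u) (fderiv ℝ ψ y v)) (u v w : Euc n) :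
    confMetric α β (ψ x) (fderiv ℝ ψ x (christoffel G x u v)) (fderiv ℝ ψ x w)
      = confMetric α β (ψ x) (confCov α β ψ (fun y => fderiv ℝ ψ y v) x u) (fderiv ℝ ψ x w) := by
  have hcompat : ∀ a b c, fderiv ℝ (fun y => G y a b) x c
      = confMetric α β (ψ x) (confCov α β ψ (fun y => fderiv ℝ ψ y a) x c) (fderiv ℝ ψ x b)
        + confMetric α β (ψ x) (fderiv ℝ ψ x a)
          (confCov α β ψ (fun y => fderiv ℝ ψ y b) x c) := fun a b c => by
    rw [EventuallyEq.fderiv_eq (hG.mono fun y hy => hy a b)]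
    exact fderiv_confMetric (hψ.differentiableAt (by norm_num)) (differentiableAt_fderiv_apply hψ a)
      (differentiableAt_fderiv_apply hψ b) hF c
  have hB := isMetricAt_pullback hF hinj hG.self_of_nhds
  refine DFunLike.congr_fun (linearMap_ext_bvec
    (f := (confMetric α β (ψ x) _).comp (fderiv ℝ ψ x).toLinearMap)
    (g := (confMetric α β (ψ x) _).comp (fderiv ℝ ψ x).toLinearMap) fun j => ?_) w
  refine (hB.koszul u v j).trans ?_
  rw [hcompat, hcompat, hcompat, confCov_fderiv_comm hψ u (bvec j),
    confCov_fderiv_comm hψ v (bvec j), confCov_fderiv_comm hψ u v,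
    confMetric_comm _ (fderiv ℝ ψ x u), confMetric_comm _ (fderiv ℝ ψ x v)]
  simp only [LinearMap.comp_apply, coe_coe]
  ring

end Pullback

section ConformalCoordinates

variable {n k : ℕ} {α β : ℝ} {H : Euc k → Euc k → Euc k → ℝ} {y : Euc k}

lemma christoffel_of_eventuallyEq_confMetric (hF : confFactor α β y ≠ 0)
    (hH : ∀ᶠ z in 𝓝 y, ∀ u v, H z u v = confMetric α β z u v) (u v : Euc k) :
    christoffel H y u v = confChristoffel α β y u v := by
  have hid : ∀ w, confMetric α β y (christoffel H y u v) w
      = confMetric α β y (confChristoffel α β y u v) w := fun w => by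
    simpa [confCov] using confMetric_fderiv_christoffel (ψ := id) contDiffAt_id hF
      (by simpa using Function.injective_id) (by simpa using hH) u v w
  refine sub_eq_zero.1 ((confMetric_self_eq_zero hF).1 ?_)
  rw [LinearMap.BilinForm.sub_left, hid, sub_self]

lemma covAlong_eq_confCov {ψ V : Euc n → Euc k} {x : Euc n} (hF : confFactor α β (ψ x) ≠ 0)
    (hH : ∀ᶠ z in 𝓝 (ψ x), ∀ u v, H z u v = confMetric α β z u v) (u : Euc n) :
    covAlong H ψ V x u = confCov α β ψ V x u := by
  rw [covAlong, christoffel_of_eventuallyEq_confMetric hF hH, confCov]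

lemma curvature_of_eventuallyEq_confMetric (hF : confFactor α β y ≠ 0)
    (hH : ∀ᶠ z in 𝓝 y, ∀ u v, H z u v = confMetric α β z u v) (u v w : Euc k) :
    curvature H y u v w
      = (4 * α * β) • (confMetric α β y v w • u - confMetric α β y u w • v) := by
  have hΓ : ∀ᶠ z in 𝓝 y, ∀ a b, christoffel H z a b = confCov α β id (fun _ => b) z a := by
    filter_upwards [hH.eventually_nhds, continuous_confFactor.continuousAt.eventually_ne hF]
      with z hz hFz a b
    simp [christoffel_of_eventuallyEq_confMetric hFz hz, confCov]
  have hderiv : ∀ a b, fderiv ℝ (fun z => christoffel H z a b) y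
      = fderiv ℝ (fun z => confCov α β id (fun _ => b) z a) y := fun a b =>
    EventuallyEq.fderiv_eq (hΓ.mono fun z hz => hz a b)
  have hRicci := confCov_confCov_sub contDiffAt_id (contDiffAt_const (c := w)) hF v u
  simp only [fderiv_id, ContinuousLinearMap.id_apply, id_eq] at hRicci
  rw [← hRicci, curvature, hderiv, hderiv]
  simp only [confCov, christoffel_of_eventuallyEq_confMetric hF hH, fderiv_id, id_eq,
    ContinuousLinearMap.id_apply, fderiv_fun_const, Pi.zero_apply, zero_apply, zero_add]

end ConformalCoordinates

section MatrixCalculus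

variable {X ι : Type*} [NormedAddCommGroup X] [NormedSpace ℝ X] [Fintype ι] [DecidableEq ι]
  {A : X → Matrix ι ι ℝ} {x : X}

lemma differentiableAt_det (hA : ∀ i j, DifferentiableAt ℝ (fun y => A y i j) x) :
    DifferentiableAt ℝ (fun y => (A y).det) x := by
  simp only [Matrix.det_apply']
  exact .fun_sum fun σ _ => (HasFDerivAt.finsetProd fun i _ =>
    (hA _ i).hasFDerivAt).differentiableAt.const_mul _

lemma differentiableAt_matrix_inv (hA : ∀ i j, DifferentiableAt ℝ (fun y => A y i j) x)
    (hdet : (A x).det ≠ 0) (i j : ι) : DifferentiableAt ℝ (fun y => (A y)⁻¹ i j) x := by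
  simp only [Matrix.inv_def, Ring.inverse_eq_inv', Matrix.smul_apply, smul_eq_mul,
    Matrix.adjugate_apply]
  refine ((differentiableAt_det hA).inv hdet).mul (differentiableAt_det fun a b => ?_)
  by_cases ha : a = j
  · simp [ha]
  · simpa [Matrix.updateRow_ne ha] using hA a b

end MatrixCalculus

section CoordinateCalculus

variable {n : ℕ} {G : Euc n → Euc n → Euc n → ℝ} {x : Euc n}
  {B : LinearMap.BilinForm ℝ (Euc n)}

lemma IsMetricAt.differentiableAt_invGram (hB : IsMetricAt G x B)
    (hG : ∀ u v, DifferentiableAt ℝ (fun y => G y u v) x) (i j : Fin n) :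
    DifferentiableAt ℝ (fun y => invGram G y i j) x :=
  differentiableAt_matrix_inv (fun i j => hG (bvec i) (bvec j)) hB.det_gram_ne_zero i j

lemma IsMetricAt.differentiableAt_dualFrame (hB : IsMetricAt G x B)
    (hG : ∀ u v, DifferentiableAt ℝ (fun y => G y u v) x) (j : Fin n) :
    DifferentiableAt ℝ (fun y => dualFrame G y j) x :=
  .fun_sum fun i _ => (hB.differentiableAt_invGram hG i j).smul_const _

lemma IsMetricAt.differentiableAt_christoffel (hB : IsMetricAt G x B)
    (hG : ∀ u v, DifferentiableAt ℝ (fun y => G y u v) x)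
    (hdG : ∀ u v w, DifferentiableAt ℝ (fun y => fderiv ℝ (fun z => G z u v) y w) x)
    (u v : Euc n) : DifferentiableAt ℝ (fun y => christoffel G y u v) x := by
  simp only [christoffel_eq_sum_dualFrame]
  exact .fun_sum fun j _ => ((((hdG v _ u).add (hdG u _ v)).sub (hdG u v _)).const_mul _).smul
    (hB.differentiableAt_dualFrame hG j)

end CoordinateCalculus

section ConnectionRules

variable {X E : Type*} [NormedAddCommGroup X] [NormedSpace ℝ X] [NormedAddCommGroup E]
  [InnerProductSpace ℝ E] {α β : ℝ} {ψ V W : X → E} {x : X}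

lemma confCov_congr (h : V =ᶠ[𝓝 x] W) : confCov α β ψ V x = confCov α β ψ W x := by
  funext u
  rw [confCov, confCov, h.fderiv_eq, h.self_of_nhds]

lemma confCov_add (hV : DifferentiableAt ℝ V x) (hW : DifferentiableAt ℝ W x) (u : X) :
    confCov α β ψ (fun y => V y + W y) x u = confCov α β ψ V x u + confCov α β ψ W x u := by
  simp only [confCov, confChristoffel, fderiv_fun_add hV hW, add_apply, inner_add_right]
  module

lemma confCov_smul {f : X → ℝ} (hf : DifferentiableAt ℝ f x) (hV : DifferentiableAt ℝ V x)
    (u : X) : confCov α β ψ (fun y => f y • V y) x u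
      = f x • confCov α β ψ V x u + fderiv ℝ f x u • V x := by
  simp only [confCov, confChristoffel, fderiv_fun_smul hf hV, add_apply, smulRight_apply,
    FunLike.coe_smul, Pi.smul_apply, inner_smul_right]
  module

lemma confCov_const_smul (r : ℝ) (hV : DifferentiableAt ℝ V x) (u : X) :
    confCov α β ψ (fun y => r • V y) x u = r • confCov α β ψ V x u := by
  simpa using confCov_smul (ψ := ψ) (differentiableAt_const r) hV u

lemma confCov_fderiv_apply (hψ : ContDiffAt ℝ 2 ψ x) {T : X → X} (hT : DifferentiableAt ℝ T x)
    (u : X) : confCov α β ψ (fun y => fderiv ℝ ψ y (T y)) x u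
      = confCov α β ψ (fun y => fderiv ℝ ψ y (T x)) x u + fderiv ℝ ψ x (fderiv ℝ T x u) := by
  have hdψ := (hψ.fderiv_right (m := 1) (by norm_num)).differentiableAt (by norm_num)
  simp only [confCov, fderiv_clm_apply hdψ hT, fderiv_clm_apply hdψ (differentiableAt_const (T x)),
    add_apply, comp_apply, flip_apply, fderiv_fun_const, Pi.zero_apply, comp_zero, zero_add]
  module

end ConnectionRules

/-! ### Umbilical submanifolds of space forms -/

/-- `ψ` is an isometric immersion of the metric `G`, on the open set `U`, into the metric `H`, which
agrees with the conformally flat metric `F⁻² ⟨·, ·⟩` near the image of `U`. -/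
structure IsConfImmersion {n k : ℕ} (α β : ℝ) (U : Set (Euc n)) (ψ : Euc n → Euc k)
    (G : Euc n → Euc n → Euc n → ℝ) (H : Euc k → Euc k → Euc k → ℝ) : Prop where
  isOpen : IsOpen U
  smooth : ∀ x ∈ U, ContDiffAt ℝ ∞ ψ x
  injective : ∀ x ∈ U, Function.Injective (fderiv ℝ ψ x)
  factor_ne : ∀ x ∈ U, confFactor α β (ψ x) ≠ 0
  target : ∀ x ∈ U, ∀ᶠ z in 𝓝 (ψ x), ∀ u v, H z u v = confMetric α β z u v
  pullback : ∀ x ∈ U, ∀ u v, G x u v = confMetric α β (ψ x) (fderiv ℝ ψ x u) (fderiv ℝ ψ x v)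

/-- The mean curvature vector `η = (1/n) Trace_g B` of a map defined on `n`-dimensional
coordinates. -/
noncomputable def meanCurvature {n k : ℕ} (G : Euc n → Euc n → Euc n → ℝ)
    (H : Euc k → Euc k → Euc k → ℝ) (ψ : Euc n → Euc k) (x : Euc n) : Euc k :=
  (1 / (n : ℝ)) • tension G H ψ x

lemma tension_eq_smul_meanCurvature {n k : ℕ} (hn : n ≠ 0) (G : Euc n → Euc n → Euc n → ℝ)
    (H : Euc k → Euc k → Euc k → ℝ) (ψ : Euc n → Euc k) (x : Euc n) :
    tension G H ψ x = (n : ℝ) • meanCurvature G H ψ x := by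
  rw [meanCurvature, smul_smul, mul_one_div_cancel (Nat.cast_ne_zero.2 hn), one_smul]

/-- Total umbilicity in coordinates: the second fundamental form is `B(u, v) = g(u, v) η`. -/
def IsUmbilicalOn {n k : ℕ} (U : Set (Euc n)) (G : Euc n → Euc n → Euc n → ℝ)
    (H : Euc k → Euc k → Euc k → ℝ) (ψ : Euc n → Euc k) : Prop :=
  ∀ x ∈ U, ∀ u v, secondFF G H ψ x u v = G x u v • meanCurvature G H ψ x

namespace IsConfImmersion

variable {n k : ℕ} {α β : ℝ} {U : Set (Euc n)} {ψ : Euc n → Euc k}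
  {G : Euc n → Euc n → Euc n → ℝ} {H : Euc k → Euc k → Euc k → ℝ} {x : Euc n}

lemma mem_nhds (h : IsConfImmersion α β U ψ G H) (hx : x ∈ U) : U ∈ 𝓝 x := h.isOpen.mem_nhds hx

lemma contDiffAt_two (h : IsConfImmersion α β U ψ G H) (hx : x ∈ U) : ContDiffAt ℝ 2 ψ x :=
  (h.smooth x hx).of_le (WithTop.coe_le_coe.2 (le_top : (2 : ℕ∞) ≤ ⊤))

lemma differentiableAt (h : IsConfImmersion α β U ψ G H) (hx : x ∈ U) : DifferentiableAt ℝ ψ x :=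
  (h.smooth x hx).differentiableAt (by simp)

lemma contDiffAt_fderiv_apply (h : IsConfImmersion α β U ψ G H) (hx : x ∈ U) (v : Euc n) :
    ContDiffAt ℝ 2 (fun y => fderiv ℝ ψ y v) x :=
  ((h.smooth x hx).fderiv_right (WithTop.coe_le_coe.2 (le_top : (2 + 1 : ℕ∞) ≤ ⊤))).clm_apply
    contDiffAt_const

lemma differentiableAt_fderiv (h : IsConfImmersion α β U ψ G H) (hx : x ∈ U) :
    DifferentiableAt ℝ (fderiv ℝ ψ) x :=
  ((h.contDiffAt_two hx).fderiv_right (m := 1) (by norm_num)).differentiableAt (by norm_num)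

lemma differentiableAt_fderiv_apply (h : IsConfImmersion α β U ψ G H) (hx : x ∈ U) (v : Euc n) :
    DifferentiableAt ℝ (fun y => fderiv ℝ ψ y v) x :=
  (h.contDiffAt_fderiv_apply hx v).differentiableAt (by norm_num)

lemma isMetricAt (h : IsConfImmersion α β U ψ G H) (hx : x ∈ U) :
    IsMetricAt G x ((confMetric α β (ψ x)).comp (fderiv ℝ ψ x).toLinearMap
      (fderiv ℝ ψ x).toLinearMap) :=
  isMetricAt_pullback (h.factor_ne x hx) (h.injective x hx) (h.pullback x hx)

lemma covAlong_eq (h : IsConfImmersion α β U ψ G H) (hx : x ∈ U) (V : Euc n → Euc k)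
    (u : Euc n) : covAlong H ψ V x u = confCov α β ψ V x u :=
  covAlong_eq_confCov (h.factor_ne x hx) (h.target x hx) u

lemma secondFF_eq (h : IsConfImmersion α β U ψ G H) (hx : x ∈ U) (u v : Euc n) :
    secondFF G H ψ x u v = confCov α β ψ (fun y => fderiv ℝ ψ y v) x u
      - fderiv ℝ ψ x (christoffel G x u v) := by
  rw [secondFF, h.covAlong_eq hx]

lemma eventually_metric_eq (h : IsConfImmersion α β U ψ G H) (hx : x ∈ U) :
    ∀ᶠ y in 𝓝 x, ∀ u v, G y u v = confMetric α β (ψ y) (fderiv ℝ ψ y u) (fderiv ℝ ψ y v) :=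
  eventually_of_mem (h.mem_nhds hx) h.pullback

lemma differentiableAt_metric (h : IsConfImmersion α β U ψ G H) (hx : x ∈ U) (u v : Euc n) :
    DifferentiableAt ℝ (fun y => G y u v) x :=
  (differentiableAt_confMetric (h.differentiableAt hx) (h.differentiableAt_fderiv_apply hx u)
    (h.differentiableAt_fderiv_apply hx v) (h.factor_ne x hx)).congr_of_eventuallyEq
      ((h.eventually_metric_eq hx).mono fun _ hy => hy u v)

lemma fderiv_metric (h : IsConfImmersion α β U ψ G H) (hx : x ∈ U) (u v w : Euc n) :
    fderiv ℝ (fun y => G y u v) x w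
      = confMetric α β (ψ x) (confCov α β ψ (fun y => fderiv ℝ ψ y u) x w) (fderiv ℝ ψ x v)
        + confMetric α β (ψ x) (fderiv ℝ ψ x u)
          (confCov α β ψ (fun y => fderiv ℝ ψ y v) x w) := by
  rw [EventuallyEq.fderiv_eq ((h.eventually_metric_eq hx).mono fun _ hy => hy u v)]
  exact fderiv_confMetric (h.differentiableAt hx) (h.differentiableAt_fderiv_apply hx u)
    (h.differentiableAt_fderiv_apply hx v) (h.factor_ne x hx) w

lemma differentiableAt_fderiv_metric (h : IsConfImmersion α β U ψ G H) (hx : x ∈ U)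
    (u v w : Euc n) : DifferentiableAt ℝ (fun y => fderiv ℝ (fun z => G z u v) y w) x := by
  have hF := h.factor_ne x hx
  have hcov : ∀ a, DifferentiableAt ℝ
      (fun y => confCov α β ψ (fun z => fderiv ℝ ψ z a) y w) x := fun a =>
    differentiableAt_confCov (h.contDiffAt_two hx) (h.contDiffAt_fderiv_apply hx a) hF w
  exact ((differentiableAt_confMetric (h.differentiableAt hx) (hcov u)
    (h.differentiableAt_fderiv_apply hx v) hF).add
      (differentiableAt_confMetric (h.differentiableAt hx) (h.differentiableAt_fderiv_apply hx u)
        (hcov v) hF)).congr_of_eventuallyEq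
      (eventually_of_mem (h.mem_nhds hx) fun y hy => h.fderiv_metric hy u v w)

lemma differentiableAt_christoffel (h : IsConfImmersion α β U ψ G H) (hx : x ∈ U) (u v : Euc n) :
    DifferentiableAt ℝ (fun y => christoffel G y u v) x :=
  (h.isMetricAt hx).differentiableAt_christoffel (h.differentiableAt_metric hx)
    (h.differentiableAt_fderiv_metric hx) u v

lemma differentiableAt_secondFF (h : IsConfImmersion α β U ψ G H) (hx : x ∈ U) (u v : Euc n) :
    DifferentiableAt ℝ (fun y => secondFF G H ψ y u v) x :=
  ((differentiableAt_confCov (h.contDiffAt_two hx) (h.contDiffAt_fderiv_apply hx v)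
    (h.factor_ne x hx) u).sub ((h.differentiableAt_fderiv hx).clm_apply
      (h.differentiableAt_christoffel hx u v))).congr_of_eventuallyEq
    (eventually_of_mem (h.mem_nhds hx) fun _ hy => h.secondFF_eq hy u v)

lemma differentiableAt_meanCurvature (h : IsConfImmersion α β U ψ G H) (hx : x ∈ U) :
    DifferentiableAt ℝ (meanCurvature G H ψ) x :=
  (DifferentiableAt.fun_sum fun _ _ => .fun_sum fun _ _ =>
    ((h.isMetricAt hx).differentiableAt_invGram (h.differentiableAt_metric hx) _ _).smul
      (h.differentiableAt_secondFF hx _ _)).const_smul (1 / (n : ℝ))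

lemma confMetric_secondFF_fderiv (h : IsConfImmersion α β U ψ G H) (hx : x ∈ U) (u v w : Euc n) :
    confMetric α β (ψ x) (secondFF G H ψ x u v) (fderiv ℝ ψ x w) = 0 := by
  rw [h.secondFF_eq hx, LinearMap.BilinForm.sub_left, sub_eq_zero]
  exact (confMetric_fderiv_christoffel (h.contDiffAt_two hx) (h.factor_ne x hx) (h.injective x hx)
    (h.eventually_metric_eq hx) u v w).symm

lemma confMetric_meanCurvature_fderiv (h : IsConfImmersion α β U ψ G H) (hx : x ∈ U)
    (w : Euc n) : confMetric α β (ψ x) (meanCurvature G H ψ x) (fderiv ℝ ψ x w) = 0 := by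
  simp only [meanCurvature, tension, traceG, map_smul, map_sum, LinearMap.smul_apply,
    LinearMap.sum_apply, h.confMetric_secondFF_fderiv hx, smul_zero, Finset.sum_const_zero]

lemma confCov_fderiv (h : IsConfImmersion α β U ψ G H) (hum : IsUmbilicalOn U G H ψ) (hx : x ∈ U)
    (u v : Euc n) : confCov α β ψ (fun y => fderiv ℝ ψ y v) x u
      = fderiv ℝ ψ x (christoffel G x u v) + G x u v • meanCurvature G H ψ x := by
  rw [← hum x hx, h.secondFF_eq hx, add_sub_cancel]

lemma confMetric_confCov_fderiv_normal (h : IsConfImmersion α β U ψ G H)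
    (hum : IsUmbilicalOn U G H ψ) (hx : x ∈ U) (u v : Euc n) {ν : Euc k}
    (hν : ∀ z, confMetric α β (ψ x) (fderiv ℝ ψ x z) ν = 0) :
    confMetric α β (ψ x) (confCov α β ψ (fun y => fderiv ℝ ψ y v) x u) ν
      = G x u v * confMetric α β (ψ x) (meanCurvature G H ψ x) ν := by
  rw [h.confCov_fderiv hum hx, LinearMap.BilinForm.add_left, hν, zero_add,
    LinearMap.BilinForm.smul_left]

lemma fderiv_metric_eq_christoffel (h : IsConfImmersion α β U ψ G H)
    (hum : IsUmbilicalOn U G H ψ) (hx : x ∈ U) (u v w : Euc n) :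
    fderiv ℝ (fun y => G y u v) x w
      = G x (christoffel G x w u) v + G x u (christoffel G x w v) := by
  rw [h.fderiv_metric hx, h.confCov_fderiv hum hx, h.confCov_fderiv hum hx,
    LinearMap.BilinForm.add_left, LinearMap.BilinForm.add_right, LinearMap.BilinForm.smul_left,
    LinearMap.BilinForm.smul_right, confMetric_comm _ (fderiv ℝ ψ x u) (meanCurvature G H ψ x),
    h.confMetric_meanCurvature_fderiv hx, h.confMetric_meanCurvature_fderiv hx, mul_zero, mul_zero,
    add_zero, add_zero, ← h.pullback x hx, ← h.pullback x hx]

lemma confMetric_confCov_confCov_normal (h : IsConfImmersion α β U ψ G H)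
    (hum : IsUmbilicalOn U G H ψ) (hx : x ∈ U) (u v w : Euc n) {ν : Euc k}
    (hν : ∀ z, confMetric α β (ψ x) (fderiv ℝ ψ x z) ν = 0) :
    confMetric α β (ψ x)
        (confCov α β ψ (fun y => confCov α β ψ (fun z => fderiv ℝ ψ z v) y u) x w) ν
      = G x u v * confMetric α β (ψ x) (confCov α β ψ (meanCurvature G H ψ) x w) ν
        + (G x w (christoffel G x u v) + fderiv ℝ (fun y => G y u v) x w)
          * confMetric α β (ψ x) (meanCurvature G H ψ x) ν := by
  have hη := h.differentiableAt_meanCurvature hx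
  have hG := h.differentiableAt_metric hx u v
  have hΓ := h.differentiableAt_christoffel hx u v
  have hgauss : (fun y => confCov α β ψ (fun z => fderiv ℝ ψ z v) y u) =ᶠ[𝓝 x]
      fun y => fderiv ℝ ψ y (christoffel G y u v) + G y u v • meanCurvature G H ψ y :=
    eventually_of_mem (h.mem_nhds hx) fun y hy => h.confCov_fderiv hum hy u v
  rw [confCov_congr hgauss,
    confCov_add ((h.differentiableAt_fderiv hx).clm_apply hΓ) (hG.fun_smul hη),
    confCov_smul hG hη, confCov_fderiv_apply (h.contDiffAt_two hx) hΓ]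
  simp only [LinearMap.BilinForm.add_left, LinearMap.BilinForm.smul_left, hν,
    h.confMetric_confCov_fderiv_normal hum hx _ _ hν]
  ring

lemma christoffel_comm (h : IsConfImmersion α β U ψ G H) (hx : x ∈ U) (u v : Euc n) :
    christoffel G x u v = christoffel G x v u := by
  have hsymm : (fun y => G y u v) =ᶠ[𝓝 x] fun y => G y v u :=
    (h.eventually_metric_eq hx).mono fun y hy => by
      simp only [hy]
      exact confMetric_comm _ _ _
  rw [christoffel_eq_sum_dualFrame, christoffel_eq_sum_dualFrame, hsymm.fderiv_eq]
  simp only [add_comm]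

lemma codazzi (h : IsConfImmersion α β U ψ G H) (hum : IsUmbilicalOn U G H ψ) (hx : x ∈ U)
    (u v w : Euc n) {ν : Euc k} (hν : ∀ z, confMetric α β (ψ x) (fderiv ℝ ψ x z) ν = 0) :
    G x u v * confMetric α β (ψ x) (confCov α β ψ (meanCurvature G H ψ) x w) ν
      = G x w v * confMetric α β (ψ x) (confCov α β ψ (meanCurvature G H ψ) x u) ν := by
  have hΓ : christoffel G x w u = christoffel G x u w := h.christoffel_comm hx w u
  have hricci := congrArg (confMetric α β (ψ x) · ν) (confCov_confCov_sub (h.contDiffAt_two hx)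
    (h.contDiffAt_fderiv_apply hx v) (h.factor_ne x hx) u w)
  simp only [LinearMap.BilinForm.sub_left, LinearMap.BilinForm.smul_left, hν, mul_zero, sub_zero,
    h.confMetric_confCov_confCov_normal hum hx _ _ _ hν,
    h.fderiv_metric_eq_christoffel hum hx] at hricci
  rw [hΓ] at hricci
  linear_combination hricci

lemma metric_self_eq_zero (h : IsConfImmersion α β U ψ G H) (hx : x ∈ U) {u : Euc n} :
    G x u u = 0 ↔ u = 0 := by
  rw [h.pullback x hx, confMetric_self_eq_zero (h.factor_ne x hx),
    map_eq_zero_iff _ (h.injective x hx)]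

lemma exists_ne_zero_metric_eq_zero (h : IsConfImmersion α β U ψ G H) (hx : x ∈ U) (hn : 2 ≤ n)
    (w : Euc n) : ∃ u, u ≠ 0 ∧ G x w u = 0 := by
  let L : Euc n →ₗ[ℝ] ℝ :=
    (confMetric α β (ψ x) (fderiv ℝ ψ x w)).comp (fderiv ℝ ψ x).toLinearMap
  have hker : LinearMap.ker L ≠ ⊥ := LinearMap.ker_ne_bot_of_finrank_lt (by simp; omega)
  obtain ⟨u, hu, hu0⟩ := Submodule.exists_mem_ne_zero_of_ne_bot hker
  exact ⟨u, hu0, (h.pullback x hx w u).trans hu⟩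

/-- In dimension at least two, the mean curvature vector is parallel in the normal bundle: apply
the Codazzi equation to `u = v` orthogonal to `w`. -/
lemma confMetric_confCov_meanCurvature_normal (h : IsConfImmersion α β U ψ G H)
    (hum : IsUmbilicalOn U G H ψ) (hx : x ∈ U) (hn : 2 ≤ n) (w : Euc n) {ν : Euc k}
    (hν : ∀ z, confMetric α β (ψ x) (fderiv ℝ ψ x z) ν = 0) :
    confMetric α β (ψ x) (confCov α β ψ (meanCurvature G H ψ) x w) ν = 0 := by
  obtain ⟨u, hu, hwu⟩ := h.exists_ne_zero_metric_eq_zero hx hn w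
  have hcodazzi := h.codazzi hum hx u u w hν
  rw [hwu, zero_mul] at hcodazzi
  exact (mul_eq_zero.1 hcodazzi).resolve_left ((h.metric_self_eq_zero hx).not.2 hu)

lemma confMetric_confCov_fderiv_of_normal (h : IsConfImmersion α β U ψ G H)
    (hum : IsUmbilicalOn U G H ψ) (hx : x ∈ U) {V : Euc n → Euc k} (hV : DifferentiableAt ℝ V x)
    (hnormal : ∀ᶠ y in 𝓝 x, ∀ z, confMetric α β (ψ y) (fderiv ℝ ψ y z) (V y) = 0) (w z : Euc n) :
    confMetric α β (ψ x) (confCov α β ψ V x w) (fderiv ℝ ψ x z)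
      = -(G x w z * confMetric α β (ψ x) (meanCurvature G H ψ x) (V x)) := by
  have hzero : fderiv ℝ (fun y => confMetric α β (ψ y) (fderiv ℝ ψ y z) (V y)) x w = 0 := by
    rw [EventuallyEq.fderiv_eq (hnormal.mono fun y hy => hy z), fderiv_fun_const]
    rfl
  rw [fderiv_confMetric (h.differentiableAt hx) (h.differentiableAt_fderiv_apply hx z) hV
    (h.factor_ne x hx), h.confMetric_confCov_fderiv_normal hum hx w z hnormal.self_of_nhds] at hzero
  rw [confMetric_comm]
  linarith

lemma confMetric_fderiv_meanCurvature (h : IsConfImmersion α β U ψ G H) (hx : x ∈ U)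
    (w : Euc n) : confMetric α β (ψ x) (fderiv ℝ ψ x w) (meanCurvature G H ψ x) = 0 := by
  rw [confMetric_comm, h.confMetric_meanCurvature_fderiv hx]

lemma confCov_meanCurvature (h : IsConfImmersion α β U ψ G H) (hum : IsUmbilicalOn U G H ψ)
    (hx : x ∈ U) (hn : 2 ≤ n) (w : Euc n) :
    confCov α β ψ (meanCurvature G H ψ) x w
      = -(confMetric α β (ψ x) (meanCurvature G H ψ x) (meanCurvature G H ψ x)
        • fderiv ℝ ψ x w) := by
  set η := meanCurvature G H ψ
  set d := confCov α β ψ η x w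
    + confMetric α β (ψ x) (η x) (η x) • fderiv ℝ ψ x w with hd
  have htangent := h.confMetric_confCov_fderiv_of_normal hum hx
    (h.differentiableAt_meanCurvature hx)
    (eventually_of_mem (h.mem_nhds hx) fun y hy => h.confMetric_fderiv_meanCurvature hy) w
  have hd_normal : ∀ z, confMetric α β (ψ x) (fderiv ℝ ψ x z) d = 0 := fun z => by
    rw [confMetric_comm, hd, LinearMap.BilinForm.add_left, LinearMap.BilinForm.smul_left, htangent,
      h.pullback x hx]
    ring
  have hdd : confMetric α β (ψ x) d d = 0 := by
    nth_rw 1 [hd]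
    rw [LinearMap.BilinForm.add_left, LinearMap.BilinForm.smul_left, hd_normal, mul_zero, add_zero]
    exact h.confMetric_confCov_meanCurvature_normal hum hx hn w hd_normal
  exact eq_neg_of_add_eq_zero_left ((confMetric_self_eq_zero (h.factor_ne x hx)).1 hdd)

lemma eventually_confMetric_meanCurvature_eq (h : IsConfImmersion α β U ψ G H)
    (hum : IsUmbilicalOn U G H ψ) (hx : x ∈ U) (hn : 2 ≤ n) :
    ∀ᶠ y in 𝓝 x, confMetric α β (ψ y) (meanCurvature G H ψ y) (meanCurvature G H ψ y)
      = confMetric α β (ψ x) (meanCurvature G H ψ x) (meanCurvature G H ψ x) := by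
  refine eventually_eq_of_fderiv_eq_zero (eventually_of_mem (h.mem_nhds hx) fun y hy => ?_)
  have hη := h.differentiableAt_meanCurvature hy
  refine ⟨differentiableAt_confMetric (h.differentiableAt hy) hη hη (h.factor_ne y hy), ?_⟩
  ext w
  rw [fderiv_confMetric (h.differentiableAt hy) hη hη (h.factor_ne y hy),
    h.confCov_meanCurvature hum hy hn, LinearMap.BilinForm.neg_left, LinearMap.BilinForm.neg_right,
    LinearMap.BilinForm.smul_left, LinearMap.BilinForm.smul_right,
    h.confMetric_fderiv_meanCurvature hy, h.confMetric_meanCurvature_fderiv hy]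
  simp

lemma covAlong_tension (h : IsConfImmersion α β U ψ G H) (hum : IsUmbilicalOn U G H ψ)
    (hx : x ∈ U) (hn : 2 ≤ n) (w : Euc n) :
    covAlong H ψ (tension G H ψ) x w
      = -((n * confMetric α β (ψ x) (meanCurvature G H ψ x) (meanCurvature G H ψ x))
        • fderiv ℝ ψ x w) := by
  rw [h.covAlong_eq hx, funext (tension_eq_smul_meanCurvature (by omega) G H ψ),
    confCov_const_smul _ (h.differentiableAt_meanCurvature hx), h.confCov_meanCurvature hum hx hn,
    smul_neg, smul_smul]

lemma bitension_eq (h : IsConfImmersion α β U ψ G H) (hum : IsUmbilicalOn U G H ψ)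
    (hx : x ∈ U) (hn : 2 ≤ n) :
    bitension G H ψ x = (n * (4 * α * β
      - confMetric α β (ψ x) (meanCurvature G H ψ x) (meanCurvature G H ψ x)))
        • tension G H ψ x := by
  set c := confMetric α β (ψ x) (meanCurvature G H ψ x) (meanCurvature G H ψ x)
  have hτ := tension_eq_smul_meanCurvature (by omega : n ≠ 0) G H ψ x
  have hDτ : ∀ v, (fun y => covAlong H ψ (tension G H ψ) y v)
      =ᶠ[𝓝 x] fun y => -(n * c) • fderiv ℝ ψ y v := fun v => by
    filter_upwards [h.mem_nhds hx, h.eventually_confMetric_meanCurvature_eq hum hx hn] with y hy hc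
    rw [h.covAlong_tension hum hy hn, hc, neg_smul]
  have hrough : ∀ u v, covAlong H ψ (fun y => covAlong H ψ (tension G H ψ) y v) x u
      - covAlong H ψ (tension G H ψ) x (christoffel G x u v) = G x u v • -(c • tension G H ψ x) :=
    fun u v => by
      rw [h.covAlong_eq hx, confCov_congr (hDτ v),
        confCov_const_smul _ (h.differentiableAt_fderiv_apply hx v), h.confCov_fderiv hum hx,
        h.covAlong_tension hum hx hn, hτ]
      module
  have hcurv : ∀ u v, curvature H (ψ x) (fderiv ℝ ψ x u) (tension G H ψ x) (fderiv ℝ ψ x v)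
      = G x u v • -((4 * α * β) • tension G H ψ x) := fun u v => by
    rw [curvature_of_eventuallyEq_confMetric (h.factor_ne x hx) (h.target x hx), h.pullback x hx,
      hτ, LinearMap.BilinForm.smul_left, h.confMetric_meanCurvature_fderiv hx]
    module
  simp only [bitension, hrough, hcurv, (h.isMetricAt hx).traceG_smul_const]
  module

lemma fBitension_eq (h : IsConfImmersion α β U ψ G H) (hum : IsUmbilicalOn U G H ψ)
    (hx : x ∈ U) (hn : 2 ≤ n) (f : Euc n → ℝ) :
    fBitension G H ψ f x
      = (n * (f x * n * (4 * α * β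
          - confMetric α β (ψ x) (meanCurvature G H ψ x) (meanCurvature G H ψ x))
          + laplaceG G f x)) • meanCurvature G H ψ x
        - (2 * (n * confMetric α β (ψ x) (meanCurvature G H ψ x) (meanCurvature G H ψ x)))
          • fderiv ℝ ψ x (gradG G f x) := by
  rw [fBitension, h.bitension_eq hum hx hn, h.covAlong_tension hum hx hn,
    tension_eq_smul_meanCurvature (by omega)]
  module

lemma fderiv_eq_zero_of_fBitension_eq_zero (h : IsConfImmersion α β U ψ G H)
    (hum : IsUmbilicalOn U G H ψ) (hx : x ∈ U) (hn : 2 ≤ n) {f : Euc n → ℝ}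
    (hη : meanCurvature G H ψ x ≠ 0) (hf : fBitension G H ψ f x = 0) : fderiv ℝ f x = 0 := by
  have hF := h.factor_ne x hx
  have hn0 : (n : ℝ) ≠ 0 := by
    norm_cast
    omega
  have hgrad := congrArg (confMetric α β (ψ x) · (fderiv ℝ ψ x (gradG G f x))) hf
  simp only [h.fBitension_eq hum hx hn, LinearMap.BilinForm.sub_left, LinearMap.BilinForm.smul_left,
    h.confMetric_meanCurvature_fderiv hx, mul_zero, zero_sub, LinearMap.BilinForm.zero_left,
    neg_eq_zero, mul_eq_zero, two_ne_zero, hn0, confMetric_self_eq_zero hF, hη, false_or] at hgrad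
  exact (h.isMetricAt hx).fderiv_eq_zero_of_gradG_eq_zero
    ((map_eq_zero_iff _ (h.injective x hx)).1 hgrad)

theorem meanCurvature_eq_zero_or (h : IsConfImmersion α β U ψ G H)
    (hum : IsUmbilicalOn U G H ψ) (hx : x ∈ U) (hn : 2 ≤ n) {f : Euc n → ℝ} (hpos : 0 < f x)
    (hf : ∀ y ∈ U, fBitension G H ψ f y = 0) :
    meanCurvature G H ψ x = 0 ∨
      confMetric α β (ψ x) (meanCurvature G H ψ x) (meanCurvature G H ψ x) = 4 * α * β := by
  refine or_iff_not_imp_left.2 fun hη => ?_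
  have hdf : ∀ᶠ y in 𝓝 x, fderiv ℝ f y = 0 := by
    filter_upwards [h.mem_nhds hx,
      (h.differentiableAt_meanCurvature hx).continuousAt.eventually_ne hη] with y hy hηy
    exact h.fderiv_eq_zero_of_fBitension_eq_zero hum hy hn hηy (hf y hy)
  have hgrad : gradG G f x = 0 := by simp [gradG, hdf.self_of_nhds]
  have hzero := hf x hx
  have hn0 : (n : ℝ) ≠ 0 := by
    norm_cast
    omega
  rw [h.fBitension_eq hum hx hn, laplaceG_eq_zero_of_eventually_fderiv_eq_zero hdf, hgrad, map_zero,
    smul_zero, sub_zero, add_zero] at hzero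
  simp only [smul_eq_zero, mul_eq_zero, hn0, hpos.ne', hη, or_false, false_or] at hzero
  linarith

lemma secondFF_eq_zero_of_nonpos (h : IsConfImmersion α β U ψ G H)
    (hum : IsUmbilicalOn U G H ψ) (hx : x ∈ U) (hn : 2 ≤ n) (hcurv : α * β ≤ 0) {f : Euc n → ℝ}
    (hpos : 0 < f x) (hf : ∀ y ∈ U, fBitension G H ψ f y = 0) (u v : Euc n) :
    secondFF G H ψ x u v = 0 := by
  have hη : meanCurvature G H ψ x = 0 := by
    rcases h.meanCurvature_eq_zero_or hum hx hn hpos hf with hη | hη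
    · exact hη
    · have hnonneg := confMetric_self_nonneg (α := α) (β := β) (ψ x) (meanCurvature G H ψ x)
      exact (confMetric_self_eq_zero (h.factor_ne x hx)).1 (by linarith)
  rw [hum x hx, hη, smul_zero]

end IsConfImmersion

/-! ### From charts to manifolds -/

section ChartDomain

variable {m n : ℕ} {M N : Type*} [TopologicalSpace M] [TopologicalSpace N] {φ : M → N}
  {e : OpenPartialHomeomorph M (Euc m)} {e' : OpenPartialHomeomorph N (Euc n)}

/-- The part of the target of the chart `e` where `φ` can be read in the chart `e'`. -/
def chartDomain (φ : M → N) (e : OpenPartialHomeomorph M (Euc m))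
    (e' : OpenPartialHomeomorph N (Euc n)) : Set (Euc m) :=
  e.target ∩ e.symm ⁻¹' (φ ⁻¹' e'.source)

lemma mem_chartDomain {p : M} (hp : p ∈ e.source) (hp' : φ p ∈ e'.source) :
    e p ∈ chartDomain φ e e' :=
  ⟨e.map_source hp, by simpa [e.left_inv hp] using hp'⟩

lemma isOpen_chartDomain (hφ : Continuous φ) : IsOpen (chartDomain φ e e') :=
  e.isOpen_inter_preimage_symm (e'.open_source.preimage hφ)

end ChartDomain

section Charts

variable {m n : ℕ} {M N : Type*} [TopologicalSpace M] [ChartedSpace (Euc m) M]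
  [TopologicalSpace N] [ChartedSpace (Euc n) N] {α β : ℝ} {g : MetricTensor m M}
  {h : MetricTensor n N} {φ : M → N} {e : OpenPartialHomeomorph M (Euc m)}
  {e' : OpenPartialHomeomorph N (Euc n)} {x : Euc m}

/-- In every chart of the atlas, `h` is the metric `F⁻² ⟨·, ·⟩` with `F = confFactor α β`; it then
has constant sectional curvature `4 α β`. -/
def IsSpaceFormMetric (α β : ℝ) (h : MetricTensor n N) : Prop :=
  ∀ e ∈ atlas (Euc n) N, ∀ y ∈ e.target, confFactor α β y ≠ 0 ∧
    ∀ u v, metricInChart h e y u v = confMetric α β y u v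

lemma IsTotallyUmbilical.isUmbilicalOn_chart (hum : IsTotallyUmbilical g h φ)
    (he : e ∈ atlas (Euc m) M) (he' : e' ∈ atlas (Euc n) N) :
    IsUmbilicalOn (chartDomain φ e e') (metricInChart g e) (metricInChart h e')
      (e' ∘ φ ∘ e.symm) := fun y hy u v => by
  have hy' := hum e he e' he' (e.symm y) (e.map_target hy.1) hy.2 u v
  rwa [e.right_inv hy.1] at hy'

lemma IsFBiharmonicMap.fBitension_chart {f : M → ℝ} (hf : IsFBiharmonicMap g h φ f)
    (he : e ∈ atlas (Euc m) M) (he' : e' ∈ atlas (Euc n) N) :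
    ∀ y ∈ chartDomain φ e e', fBitension (metricInChart g e) (metricInChart h e')
      (e' ∘ φ ∘ e.symm) (f ∘ e.symm) y = 0 := fun y hy => by
  have hy' := hf e he e' he' (e.symm y) (e.map_target hy.1) hy.2
  rwa [e.right_inv hy.1] at hy'

lemma contMDiffAt_symm_of_mem_atlas [IsManifold (𝓡 m) ∞ M] (he : e ∈ atlas (Euc m) M)
    (hx : x ∈ e.target) : ContMDiffAt (𝓡 m) (𝓡 m) ∞ e.symm x :=
  (contMDiffOn_symm_of_mem_maximalAtlas (IsManifold.subset_maximalAtlas he)).contMDiffAt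
    (e.open_target.mem_nhds hx)

lemma mfderiv_symm_injective [IsManifold (𝓡 m) ∞ M] (he : e ∈ atlas (Euc m) M)
    (hx : x ∈ e.target) : Function.Injective (mfderiv (𝓡 m) (𝓡 m) e.symm x) :=
  (mdifferentiable_of_mem_atlas he).symm.mfderiv_injective hx

lemma mfderiv_mfderiv_symm [IsManifold (𝓡 m) ∞ M] {F : Type*} [NormedAddCommGroup F]
    [NormedSpace ℝ F] {ι : M → F} (he : e ∈ atlas (Euc m) M) (hx : x ∈ e.target)
    (hι : MDifferentiableAt (𝓡 m) 𝓘(ℝ, F) ι (e.symm x)) (u : Euc m) :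
    mfderiv (𝓡 m) 𝓘(ℝ, F) ι (e.symm x) (mfderiv (𝓡 m) (𝓡 m) e.symm x u)
      = fderiv ℝ (ι ∘ e.symm) x u := by
  rw [← mfderiv_eq_fderiv]
  exact (mfderiv_comp_apply x hι
    ((contMDiffAt_symm_of_mem_atlas he hx).mdifferentiableAt (by simp)) u).symm

variable [IsManifold (𝓡 m) ∞ M] [IsManifold (𝓡 n) ∞ N]

lemma contDiffAt_chart (hφ : ContMDiff (𝓡 m) (𝓡 n) ∞ φ) (he : e ∈ atlas (Euc m) M)
    (he' : e' ∈ atlas (Euc n) N) (hx : x ∈ chartDomain φ e e') :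
    ContDiffAt ℝ ∞ (e' ∘ φ ∘ e.symm) x :=
  (((contMDiffOn_of_mem_maximalAtlas (IsManifold.subset_maximalAtlas he')).contMDiffAt
    (e'.open_source.mem_nhds hx.2)).comp x
      ((hφ _).comp x (contMDiffAt_symm_of_mem_atlas he hx.1))).contDiffAt

lemma mfderiv_symm_fderiv_chart (hφ : ContMDiff (𝓡 m) (𝓡 n) ∞ φ) (he : e ∈ atlas (Euc m) M)
    (he' : e' ∈ atlas (Euc n) N) (hx : x ∈ chartDomain φ e e') (u : Euc m) :
    mfderiv (𝓡 n) (𝓡 n) e'.symm ((e' ∘ φ ∘ e.symm) x) (fderiv ℝ (e' ∘ φ ∘ e.symm) x u)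
      = mfderiv (𝓡 m) (𝓡 n) φ (e.symm x) (mfderiv (𝓡 m) (𝓡 m) e.symm x u) := by
  have hlift : e'.symm ∘ (e' ∘ φ ∘ e.symm) =ᶠ[𝓝 x] φ ∘ e.symm := by
    filter_upwards [(isOpen_chartDomain hφ.continuous).mem_nhds hx] with y hy using e'.left_inv hy.2
  have hcomp := mfderiv_comp_apply x ((contMDiffAt_symm_of_mem_atlas he'
    (e'.map_source hx.2)).mdifferentiableAt (by simp))
    ((contDiffAt_chart hφ he he' hx).contMDiffAt.mdifferentiableAt (by simp)) u
  rw [hlift.mfderiv_eq, mfderiv_eq_fderiv] at hcomp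
  exact hcomp.symm.trans (mfderiv_comp_apply x ((hφ _).mdifferentiableAt (by simp))
    ((contMDiffAt_symm_of_mem_atlas he hx.1).mdifferentiableAt (by simp)) u)

lemma metricInChart_eq_pullback (hφ : IsIsometricImmersion g h φ) (he : e ∈ atlas (Euc m) M)
    (he' : e' ∈ atlas (Euc n) N) (hx : x ∈ chartDomain φ e e') (u v : Euc m) :
    metricInChart g e x u v = metricInChart h e' ((e' ∘ φ ∘ e.symm) x)
      (fderiv ℝ (e' ∘ φ ∘ e.symm) x u) (fderiv ℝ (e' ∘ φ ∘ e.symm) x v) := by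
  have hpoint : φ (e.symm x) = e'.symm ((e' ∘ φ ∘ e.symm) x) := (e'.left_inv hx.2).symm
  have hh : ∀ p q : N, p = q → ∀ a b : Euc n, h p a b = h q a b := by
    rintro p _ rfl a b
    rfl
  refine (hφ.2 (e.symm x) _ _).symm.trans ((hh _ _ hpoint _ _).trans ?_)
  exact congrArg₂ (h _) (mfderiv_symm_fderiv_chart hφ.1 he he' hx u).symm
    (mfderiv_symm_fderiv_chart hφ.1 he he' hx v).symm

lemma isConfImmersion_chart (hg : ∀ p u, g p u u = 0 → u = 0) (hh : IsSpaceFormMetric α β h)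
    (hφ : IsIsometricImmersion g h φ) (he : e ∈ atlas (Euc m) M) (he' : e' ∈ atlas (Euc n) N) :
    IsConfImmersion α β (chartDomain φ e e') (e' ∘ φ ∘ e.symm) (metricInChart g e)
      (metricInChart h e') := by
  have htarget : ∀ y ∈ chartDomain φ e e', (e' ∘ φ ∘ e.symm) y ∈ e'.target := fun y hy =>
    e'.map_source hy.2
  have hpullback : ∀ y ∈ chartDomain φ e e', ∀ u v, metricInChart g e y u v
      = confMetric α β ((e' ∘ φ ∘ e.symm) y) (fderiv ℝ (e' ∘ φ ∘ e.symm) y u)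
        (fderiv ℝ (e' ∘ φ ∘ e.symm) y v) := fun y hy u v => by
    rw [metricInChart_eq_pullback hφ he he' hy, (hh e' he' _ (htarget y hy)).2]
  refine ⟨isOpen_chartDomain hφ.1.continuous, fun y hy => contDiffAt_chart hφ.1 he he' hy,
    fun y hy => ?_, fun y hy => (hh e' he' _ (htarget y hy)).1, fun y hy => ?_, hpullback⟩
  · refine (injective_iff_map_eq_zero _).2 fun u hu => mfderiv_symm_injective he hy.1 ?_
    have hzero := hpullback y hy u u
    rw [hu, LinearMap.BilinForm.zero_left] at hzero
    exact (hg _ _ hzero).trans (map_zero _).symm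
  · filter_upwards [e'.open_target.mem_nhds (htarget y hy)] with z hz using (hh e' he' z hz).2

end Charts

theorem isTotallyGeodesic_of_nonpos_curvature {m n : ℕ} (hm : 2 ≤ m) {M N : Type*}
    [TopologicalSpace M] [ChartedSpace (Euc m) M] [IsManifold (𝓡 m) ∞ M] [TopologicalSpace N]
    [ChartedSpace (Euc n) N] [IsManifold (𝓡 n) ∞ N] {g : MetricTensor m M} {h : MetricTensor n N}
    {α β : ℝ} {φ : M → N} (hg : ∀ p u, g p u u = 0 → u = 0) (hh : IsSpaceFormMetric α β h)
    (hcurv : α * β ≤ 0) (hφ : IsIsometricImmersion g h φ) (hum : IsTotallyUmbilical g h φ)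
    (hbih : IsFBiharmonic g h φ) : IsTotallyGeodesic g h φ := by
  intro e he e' he' p hp hp' u v
  obtain ⟨f, -, hpos, hf⟩ := hbih
  exact (isConfImmersion_chart hg hh hφ he he').secondFF_eq_zero_of_nonpos
    (hum.isUmbilicalOn_chart he he') (mem_chartDomain hp hp') hm hcurv (hpos _)
    (hf.fBitension_chart he he') u v

lemma metricOf_self_eq_zero {n : ℕ} {N : Type*} [TopologicalSpace N] [ChartedSpace (Euc n) N]
    [IsManifold (𝓡 n) ∞ N]
    (g : Bundle.ContMDiffRiemannianMetric (𝓡 n) ∞ (Euc n) (fun p : N => TangentSpace (𝓡 n) p))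
    (p : N) (u : TangentSpace (𝓡 n) p) (hu : metricOf g p u u = 0) : u = 0 := by
  by_contra hne
  exact (g.pos p u hne).ne' hu

/-! ### The charts of the space forms -/

lemma isSpaceFormMetric_euclidean (n : ℕ) : IsSpaceFormMetric 1 0 (euclideanMetric n) := by
  intro e he y _
  rw [chartedSpaceSelf_atlas] at he
  subst he
  have hid : mfderiv (𝓡 n) (𝓡 n) (OpenPartialHomeomorph.refl (Euc n)).symm y
      = ContinuousLinearMap.id ℝ (Euc n) := mfderiv_id
  refine ⟨by simp [confFactor], fun u v => ?_⟩
  simp only [metricInChart, euclideanMetric, confMetric_apply, confFactor, hid, zero_mul, add_zero,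
    one_pow, inv_one, one_mul]
  rfl

lemma isSpaceFormMetric_hyperbolic (n : ℕ) :
    IsSpaceFormMetric (1 / 2) (-1 / 2) (hyperbolicMetric n) := by
  intro e he y hy
  have hcoe : ∀ z ∈ e.target, ((e.symm z : HypSpace n) : Euc n) = z := fun z hz => by
    obtain ⟨q, hq, rfl⟩ : ∃ (q : Euc n) (hq : q ∈ unitBall n),
        (chartAt (Euc n) q).subtypeRestr ⟨⟨q, hq⟩⟩ = e := by
      simpa [atlas, ChartedSpace.atlas] using he
    exact OpenPartialHomeomorph.right_inv _ hz
  have hball : ‖y‖ < 1 := by simpa [unitBall, hcoe y hy] using (e.symm y).2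
  have hpos : 0 < 1 - ‖y‖ ^ 2 := by nlinarith [norm_nonneg y]
  have hF : confFactor (1 / 2) (-1 / 2) y = (1 - ‖y‖ ^ 2) / 2 := by
    rw [confFactor, real_inner_self_eq_norm_sq]
    ring
  have hderiv : ∀ u : Euc n, mfderiv (𝓡 n) (𝓡 n) (Subtype.val : HypSpace n → Euc n) (e.symm y)
      (mfderiv (𝓡 n) (𝓡 n) e.symm y u) = u := fun u => by
    have hid : (Subtype.val : HypSpace n → Euc n) ∘ e.symm =ᶠ[𝓝 y] id := by
      filter_upwards [e.open_target.mem_nhds hy] with z hz using hcoe z hz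
    refine (mfderiv_mfderiv_symm he hy
      ((contMDiff_subtype_val (n := ∞) _).mdifferentiableAt (by simp)) u).trans ?_
    rw [hid.fderiv_eq, fderiv_id, ContinuousLinearMap.id_apply]
  refine ⟨by rw [hF]; positivity, fun u v => ?_⟩
  simp only [metricInChart, hyperbolicMetric, euclideanMetric, hderiv, hcoe y hy, confMetric_apply,
    hF]
  field_simp
  ring

section Stereographic

variable {X E E' : Type*} [NormedAddCommGroup X] [NormedSpace ℝ X] [NormedAddCommGroup E]
  [InnerProductSpace ℝ E] [NormedAddCommGroup E'] [InnerProductSpace ℝ E']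

/-- The inverse of the stereographic projection from the unit vector `v`, where the hyperplane
orthogonal to `v` is identified with `E` by means of the isometry `J`. -/
noncomputable def stereoInv (J : E →ₗᵢ[ℝ] E') (v : E') (y : E) : E' :=
  (confFactor 1 (1 / 4) y)⁻¹ • (J y - (2 : ℝ) • v) + v

lemma confFactor_stereo_ne_zero (y : E) : confFactor 1 (1 / 4) y ≠ 0 := by
  have hnonneg := real_inner_self_nonneg (x := y)
  unfold confFactor
  positivity

lemma inner_self_eq_confFactor_stereo (y : E) : ⟪y, y⟫ = 4 * (confFactor 1 (1 / 4) y - 1) := by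
  rw [confFactor]
  ring

variable {J : E →ₗᵢ[ℝ] E'} {v : E'}

lemma hasFDerivAt_stereoInv (y : E) :
    HasFDerivAt (stereoInv J v) ((confFactor 1 (1 / 4) y)⁻¹ • J.toContinuousLinearMap
      + ((-(confFactor 1 (1 / 4) y ^ 2)⁻¹ * (2 * (1 / 4))) • innerSL ℝ y).smulRight
        (J y - (2 : ℝ) • v)) y := by
  have hinv := hasFDerivAt_inv_confFactor (α := 1) (β := 1 / 4) (differentiableAt_id (x := y))
    (confFactor_stereo_ne_zero y)
  rw [fderiv_id, comp_id] at hinv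
  exact (hinv.smul (J.toContinuousLinearMap.hasFDerivAt.sub_const ((2 : ℝ) • v))).add_const v

lemma fderiv_stereoInv_apply (y u : E) : fderiv ℝ (stereoInv J v) y u
    = (confFactor 1 (1 / 4) y)⁻¹ • J u
      - (1 / 2 * ⟪y, u⟫ * (confFactor 1 (1 / 4) y ^ 2)⁻¹) • (J y - (2 : ℝ) • v) := by
  rw [(hasFDerivAt_stereoInv y).fderiv]
  simp only [add_apply, FunLike.coe_smul, Pi.smul_apply, smulRight_apply, innerSL_apply_apply,
    LinearIsometry.coe_toContinuousLinearMap]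
  module

lemma contDiff_stereoInv : ContDiff ℝ ∞ (stereoInv J v) := by
  have hF : ContDiff ℝ ∞ (confFactor 1 (1 / 4) : E → ℝ) := by
    unfold confFactor
    exact contDiff_const.add (contDiff_const.mul (contDiff_id.inner ℝ contDiff_id))
  exact ((hF.inv confFactor_stereo_ne_zero).smul
    (J.toContinuousLinearMap.contDiff.sub contDiff_const)).add contDiff_const

lemma fderiv_stereoInv_comp_apply {ψ : X → E} {x : X} (hψ : DifferentiableAt ℝ ψ x) (u : X) :
    fderiv ℝ (fun y => stereoInv J v (ψ y)) x u
      = fderiv ℝ (stereoInv J v) (ψ x) (fderiv ℝ ψ x u) :=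
  DFunLike.congr_fun (fderiv_comp x (hasFDerivAt_stereoInv (ψ x)).differentiableAt hψ) u

/-- The Gauss formula for the unit sphere, in stereographic coordinates. -/
lemma fderiv_fderiv_stereoInv_apply {ψ V : X → E} {x : X} (hψ : DifferentiableAt ℝ ψ x)
    (hV : DifferentiableAt ℝ V x) (u : X) :
    fderiv ℝ (fun y => fderiv ℝ (stereoInv J v) (ψ y) (V y)) x u
      = fderiv ℝ (stereoInv J v) (ψ x) (confCov 1 (1 / 4) ψ V x u)
        - confMetric 1 (1 / 4) (ψ x) (fderiv ℝ ψ x u) (V x) • stereoInv J v (ψ x) := by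
  have hF := confFactor_stereo_ne_zero (ψ x)
  have hinv := hasFDerivAt_inv_confFactor (α := 1) (β := 1 / 4) hψ hF
  have hJ : ∀ {W : X → E}, DifferentiableAt ℝ W x →
      HasFDerivAt (fun y => J (W y)) (J.toContinuousLinearMap.comp (fderiv ℝ W x)) x := fun hW =>
    J.toContinuousLinearMap.hasFDerivAt.comp x hW.hasFDerivAt
  have hderiv := (hinv.smul (hJ hV)).sub
    ((((hψ.hasFDerivAt.inner ℝ hV.hasFDerivAt).const_mul (1 / 2)).mul (hinv.pow 2)).smul
      ((hJ hψ).sub_const ((2 : ℝ) • v)))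
  simp only [fderiv_stereoInv_apply, ← inv_pow]
  refine (DFunLike.congr_fun hderiv.fderiv u).trans ?_
  simp only [confCov, confChristoffel, stereoInv, confMetric_apply, fderivInnerCLM_apply,
    inner_self_eq_confFactor_stereo, inner_add_right, inner_sub_right, inner_neg_right,
    inner_smul_right, one_div, neg_mul, neg_smul, smul_neg, smul_add, inv_pow, Pi.mul_apply,
    Nat.add_one_sub_one, pow_one, nsmul_eq_mul, Nat.cast_ofNat, sub_apply, add_apply, smul_apply,
    neg_apply, comp_apply, smulRight_apply, LinearIsometry.coe_toContinuousLinearMap,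
    coe_innerSL_apply, smul_eq_mul, ContinuousLinearMap.prod_apply, map_add, map_neg, map_smul,
    map_sub]
  match_scalars <;> field_simp <;> ring

variable (hv : ‖v‖ = 1) (hJ : ∀ y, ⟪J y, v⟫ = 0)
include hv hJ

lemma inner_fderiv_stereoInv (y u w : E) :
    ⟪fderiv ℝ (stereoInv J v) y u, fderiv ℝ (stereoInv J v) y w⟫
      = confMetric 1 (1 / 4) y u w := by
  have hF := confFactor_stereo_ne_zero y
  have hvv : ⟪v, v⟫ = 1 := by rw [real_inner_self_eq_norm_sq, hv, one_pow]
  have hJ' : ∀ z, ⟪v, J z⟫ = 0 := fun z => by rw [real_inner_comm, hJ]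
  simp only [fderiv_stereoInv_apply, confMetric_apply, inner_sub_left, inner_sub_right,
    inner_smul_left, inner_smul_right, RCLike.conj_to_real, LinearIsometry.inner_map_map, hvv, hJ,
    hJ', inner_self_eq_confFactor_stereo y, real_inner_comm y u]
  field_simp
  ring

lemma inner_stereoInv_fderiv (y u : E) :
    ⟪stereoInv J v y, fderiv ℝ (stereoInv J v) y u⟫ = 0 := by
  have hF := confFactor_stereo_ne_zero y
  have hvv : ⟪v, v⟫ = 1 := by rw [real_inner_self_eq_norm_sq, hv, one_pow]
  have hJ' : ∀ z, ⟪v, J z⟫ = 0 := fun z => by rw [real_inner_comm, hJ]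
  simp only [stereoInv, fderiv_stereoInv_apply, inner_sub_left, inner_sub_right, inner_add_left,
    inner_smul_left, inner_smul_right, RCLike.conj_to_real, LinearIsometry.inner_map_map, hvv, hJ,
    hJ', inner_self_eq_confFactor_stereo y]
  field_simp
  ring

lemma inner_stereoInv_self (y : E) : ⟪stereoInv J v y, stereoInv J v y⟫ = 1 := by
  have hF := confFactor_stereo_ne_zero y
  have hvv : ⟪v, v⟫ = 1 := by rw [real_inner_self_eq_norm_sq, hv, one_pow]
  have hJ' : ∀ z, ⟪v, J z⟫ = 0 := fun z => by rw [real_inner_comm, hJ]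
  simp only [stereoInv, inner_sub_left, inner_sub_right, inner_add_left, inner_add_right,
    inner_smul_left, inner_smul_right, RCLike.conj_to_real, LinearIsometry.inner_map_map, hvv, hJ,
    hJ', inner_self_eq_confFactor_stereo y]
  field_simp
  ring

end Stereographic

section SphereCharts

variable {n : ℕ}

lemma stereographic'_symm_eq_stereoInv [Fact (Module.finrank ℝ (Euc (n + 1)) = n + 1)]
    (v : UnitSphere n) : ∃ J : Euc n →ₗᵢ[ℝ] Euc (n + 1), (∀ y, ⟪J y, (v : Euc (n + 1))⟫ = 0) ∧
      ∀ y, ((stereographic' n v).symm y : Euc (n + 1)) = stereoInv J v y := by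
  let V : (Submodule.span ℝ {(v : Euc (n + 1))})ᗮ ≃ₗᵢ[ℝ] Euc n :=
    (OrthonormalBasis.fromOrthogonalSpanSingleton n (ne_zero_of_mem_unit_sphere v)).repr
  refine ⟨(Submodule.subtypeₗᵢ _).comp V.symm.toLinearIsometry,
    fun y => Submodule.mem_orthogonal_singleton_iff_inner_left.1 (V.symm y).2, fun y => ?_⟩
  have hnorm : ‖((V.symm y : (Submodule.span ℝ {(v : Euc (n + 1))})ᗮ) : Euc (n + 1))‖ ^ 2
      = 4 * (confFactor 1 (1 / 4) y - 1) := by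
    rw [← inner_self_eq_confFactor_stereo, real_inner_self_eq_norm_sq]
    exact congrArg (· ^ 2) (V.symm.norm_map y)
  have hF := confFactor_stereo_ne_zero y
  rw [stereographic'_symm_apply]
  change (‖((V.symm y : _) : Euc (n + 1))‖ ^ 2 + 4)⁻¹ • (4 : ℝ) • ((V.symm y : _) : Euc (n + 1)) +
    (‖((V.symm y : _) : Euc (n + 1))‖ ^ 2 + 4)⁻¹ • (‖((V.symm y : _) : Euc (n + 1))‖ ^ 2 - 4) •
      (v : Euc (n + 1)) = (confFactor 1 (1 / 4) y)⁻¹ • (((V.symm y : _) : Euc (n + 1))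
        - (2 : ℝ) • (v : Euc (n + 1))) + v
  rw [hnorm, show 4 * (confFactor 1 (1 / 4) y - 1) + 4 = 4 * confFactor 1 (1 / 4) y by ring]
  match_scalars <;> field_simp
  ring

lemma exists_stereoInv_eq_symm {e : OpenPartialHomeomorph (UnitSphere n) (Euc n)}
    (he : e ∈ atlas (Euc n) (UnitSphere n)) :
    ∃ (J : Euc n →ₗᵢ[ℝ] Euc (n + 1)) (v : Euc (n + 1)), ‖v‖ = 1 ∧ (∀ y, ⟪J y, v⟫ = 0) ∧
      Subtype.val ∘ e.symm = stereoInv J v := by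
  have := Fact.mk (@finrank_euclideanSpace_fin ℝ _ (n + 1))
  obtain ⟨v, rfl⟩ : ∃ v : UnitSphere n, e = stereographic' n v := he
  obtain ⟨J, hJ, hsymm⟩ := stereographic'_symm_eq_stereoInv v
  exact ⟨J, v, norm_eq_of_mem_sphere v, hJ, funext hsymm⟩

lemma isSpaceFormMetric_sphere (n : ℕ) : IsSpaceFormMetric 1 (1 / 4) (sphereMetric n) := by
  intro e he y hy
  have := Fact.mk (@finrank_euclideanSpace_fin ℝ _ (n + 1))
  obtain ⟨J, v, hv, hJ, hsymm⟩ := exists_stereoInv_eq_symm he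
  refine ⟨confFactor_stereo_ne_zero y, fun u w => ?_⟩
  have hderiv : ∀ u : Euc n, mfderiv (𝓡 n) (𝓡 (n + 1)) (Subtype.val : UnitSphere n → Euc (n + 1))
      (e.symm y) (mfderiv (𝓡 n) (𝓡 n) e.symm y u) = fderiv ℝ (stereoInv J v) y u := fun u => by
    rw [← hsymm]
    exact mfderiv_mfderiv_symm he hy
      ((contMDiff_coe_sphere (m := ∞) _).mdifferentiableAt (by simp)) u
  simp only [metricInChart, sphereMetric, euclideanMetric, hderiv]
  exact inner_fderiv_stereoInv hv hJ y u w

end SphereCharts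

/-! ### Unit normal fields -/

/-- Near `x`, the vector field `N` along `ψ` is differentiable, of length one and normal to `ψ`. -/
def IsUnitNormalNear {n k : ℕ} (α β : ℝ) (ψ N : Euc n → Euc k) (x : Euc n) : Prop :=
  ∀ᶠ y in 𝓝 x, DifferentiableAt ℝ N y ∧ confMetric α β (ψ y) (N y) (N y) = 1 ∧
    ∀ w, confMetric α β (ψ y) (fderiv ℝ ψ y w) (N y) = 0

/-- The component of the constant vector `ν` normal to the immersion `ψ` with induced metric `G`. -/
noncomputable def normalPart {n k : ℕ} (α β : ℝ) (G : Euc n → Euc n → Euc n → ℝ)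
    (ψ : Euc n → Euc k) (ν : Euc k) (x : Euc n) : Euc k :=
  ν - fderiv ℝ ψ x (∑ j, confMetric α β (ψ x) ν (fderiv ℝ ψ x (bvec j)) • dualFrame G x j)

/-- Near `x`, the map `F` takes values in the hyperplane `⟪·, C⟫ = c`. With the normalization
`⟪C, C⟫ = 1 + c²`, this hyperplane meets the unit sphere in a small sphere of radius
`(1 + c²)^{-1/2}` and mean curvature `|c|`. -/
def IsLocallyInSmallSphere {X E : Type*} [TopologicalSpace X] [NormedAddCommGroup E]
    [InnerProductSpace ℝ E] (F : X → E) (C : E) (c : ℝ) (x : X) : Prop :=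
  ⟪C, C⟫ = 1 + c ^ 2 ∧ ∀ᶠ y in 𝓝 x, ⟪F y, C⟫ = c

namespace IsConfImmersion

section NormalPart

variable {n k : ℕ} {α β : ℝ} {U : Set (Euc n)} {ψ : Euc n → Euc k}
  {G : Euc n → Euc n → Euc n → ℝ} {H : Euc k → Euc k → Euc k → ℝ} {x : Euc n}

lemma confMetric_fderiv_normalPart (h : IsConfImmersion α β U ψ G H) (hx : x ∈ U) (ν : Euc k)
    (w : Euc n) : confMetric α β (ψ x) (fderiv ℝ ψ x w) (normalPart α β G ψ ν x) = 0 := by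
  suffices hzero : (confMetric α β (ψ x) (normalPart α β G ψ ν x)).comp (fderiv ℝ ψ x).toLinearMap
      = 0 by
    rw [confMetric_comm]
    exact DFunLike.congr_fun hzero w
  refine linearMap_ext_bvec fun j => ?_
  have hdual := (h.isMetricAt hx).apply_sum_dualFrame_bvec
    (fun i => confMetric α β (ψ x) ν (fderiv ℝ ψ x (bvec i))) j
  rw [LinearMap.comp_apply, normalPart, map_sub, LinearMap.sub_apply, LinearMap.zero_apply,
    sub_eq_zero]
  exact hdual.symm

lemma normalPart_of_normal {ν : Euc k}
    (hν : ∀ w, confMetric α β (ψ x) (fderiv ℝ ψ x w) ν = 0) : normalPart α β G ψ ν x = ν := by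
  simp [normalPart, confMetric_comm _ ν, hν]

lemma differentiableAt_normalPart (h : IsConfImmersion α β U ψ G H) (hx : x ∈ U) (ν : Euc k) :
    DifferentiableAt ℝ (normalPart α β G ψ ν) x :=
  ((h.differentiableAt_fderiv hx).clm_apply (.fun_sum fun j _ =>
    (differentiableAt_confMetric (h.differentiableAt hx) (differentiableAt_const ν)
      (h.differentiableAt_fderiv_apply hx _) (h.factor_ne x hx)).smul
        ((h.isMetricAt hx).differentiableAt_dualFrame
          (h.differentiableAt_metric hx) j))).const_sub ν

lemma exists_isUnitNormalNear (h : IsConfImmersion α β U ψ G H) (hx : x ∈ U) (hnk : n < k) :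
    ∃ N, IsUnitNormalNear α β ψ N x := by
  have hker : LinearMap.ker ((confMetric α β (ψ x)).compl₂ (fderiv ℝ ψ x).toLinearMap) ≠ ⊥ :=
    LinearMap.ker_ne_bot_of_finrank_lt (by simpa [Module.finrank_linearMap] using hnk)
  obtain ⟨ν, hν, hν0⟩ := Submodule.exists_mem_ne_zero_of_ne_bot hker
  have hnormal : ∀ w, confMetric α β (ψ x) (fderiv ℝ ψ x w) ν = 0 := fun w => by
    rw [confMetric_comm]
    exact DFunLike.congr_fun hν w
  have hVx : normalPart α β G ψ ν x ≠ 0 := by rwa [normalPart_of_normal hnormal]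
  set V := normalPart α β G ψ ν
  refine ⟨fun y => (√(confMetric α β (ψ y) (V y) (V y)))⁻¹ • V y, ?_⟩
  filter_upwards [h.mem_nhds hx,
    (h.differentiableAt_normalPart hx ν).continuousAt.eventually_ne hVx] with y hy hVy
  have hV := h.differentiableAt_normalPart hy ν
  have hpos : 0 < confMetric α β (ψ y) (V y) (V y) :=
    (confMetric_self_nonneg _ _).lt_of_ne' ((confMetric_self_eq_zero (h.factor_ne y hy)).not.2 hVy)
  refine ⟨(((differentiableAt_confMetric (h.differentiableAt hy) hV hV
    (h.factor_ne y hy)).sqrt hpos.ne').inv (Real.sqrt_ne_zero'.2 hpos)).smul hV, ?_, fun w => ?_⟩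
  · rw [LinearMap.BilinForm.smul_left, LinearMap.BilinForm.smul_right, ← mul_assoc, ← mul_inv,
      Real.mul_self_sqrt hpos.le, inv_mul_cancel₀ hpos.ne']
  · rw [LinearMap.BilinForm.smul_right, h.confMetric_fderiv_normalPart hy, mul_zero]

lemma exists_isUnitNormalNear_smul_eq_meanCurvature (h : IsConfImmersion α β U ψ G H)
    (hum : IsUmbilicalOn U G H ψ) (hx : x ∈ U) (hn : 2 ≤ n) (hnk : n < k) (hαβ : 4 * α * β = 1)
    {f : Euc n → ℝ} (hpos : 0 < f x) (hf : ∀ y ∈ U, fBitension G H ψ f y = 0) :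
    ∃ N c, (c = 0 ∨ c = 1) ∧ IsUnitNormalNear α β ψ N x ∧
      ∀ᶠ y in 𝓝 x, meanCurvature G H ψ y = (c : ℝ) • N y := by
  have hconst := h.eventually_confMetric_meanCurvature_eq hum hx hn
  rcases h.meanCurvature_eq_zero_or hum hx hn hpos hf with hη | hη
  · obtain ⟨N, hN⟩ := h.exists_isUnitNormalNear hx hnk
    refine ⟨N, 0, .inl rfl, hN, ?_⟩
    filter_upwards [hconst, h.mem_nhds hx] with y hηy hy
    rw [hη, LinearMap.BilinForm.zero_left, confMetric_self_eq_zero (h.factor_ne y hy)] at hηy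
    rw [hηy, zero_smul]
  · refine ⟨meanCurvature G H ψ, 1, .inr rfl, ?_, by simp only [one_smul, eventually_true]⟩
    filter_upwards [hconst, h.mem_nhds hx] with y hηy hy
    exact ⟨h.differentiableAt_meanCurvature hy, by rw [hηy, hη, hαβ],
      h.confMetric_fderiv_meanCurvature hy⟩

end NormalPart

section Hypersurface

variable {n : ℕ} {α β : ℝ} {U : Set (Euc n)} {ψ : Euc n → Euc (n + 1)}
  {G : Euc n → Euc n → Euc n → ℝ} {H : Euc (n + 1) → Euc (n + 1) → Euc (n + 1) → ℝ} {x : Euc n}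

lemma eq_zero_of_confMetric_eq_zero (h : IsConfImmersion α β U ψ G H) (hx : x ∈ U)
    {ν d : Euc (n + 1)} (hν : confMetric α β (ψ x) ν ν = 1)
    (hν_normal : ∀ w, confMetric α β (ψ x) (fderiv ℝ ψ x w) ν = 0)
    (hd_normal : ∀ w, confMetric α β (ψ x) (fderiv ℝ ψ x w) d = 0)
    (hdν : confMetric α β (ψ x) ν d = 0) : d = 0 := by
  let T : Euc n × ℝ →ₗ[ℝ] Euc (n + 1) :=
    (fderiv ℝ ψ x).toLinearMap.coprod (LinearMap.toSpanSingleton ℝ _ ν)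
  have hT : ∀ u t, T (u, t) = fderiv ℝ ψ x u + t • ν := fun u t => by simp [T]
  have hT_inj : Function.Injective T := by
    refine (injective_iff_map_eq_zero _).2 fun ⟨u, t⟩ hut => ?_
    rw [hT] at hut
    have ht := congrArg (confMetric α β (ψ x) · ν) hut
    simp only [LinearMap.BilinForm.add_left, LinearMap.BilinForm.smul_left, hν_normal, hν,
      LinearMap.BilinForm.zero_left, zero_add, mul_one] at ht
    rw [ht, zero_smul, add_zero, map_eq_zero_iff _ (h.injective x hx)] at hut
    rw [hut, ht, Prod.mk_zero_zero]
  obtain ⟨⟨u, t⟩, hut⟩ :=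
    (LinearMap.injective_iff_surjective_of_finrank_eq_finrank (by simp)).1 hT_inj d
  refine (confMetric_self_eq_zero (h.factor_ne x hx)).1 ?_
  nth_rw 1 [← hut]
  rw [hT, LinearMap.BilinForm.add_left, LinearMap.BilinForm.smul_left, hd_normal, hdν, mul_zero,
    add_zero]

lemma confCov_unitNormal (h : IsConfImmersion α β U ψ G H) (hum : IsUmbilicalOn U G H ψ)
    (hx : x ∈ U) {N : Euc n → Euc (n + 1)} {c : ℝ} (hN : IsUnitNormalNear α β ψ N x)
    (hη : meanCurvature G H ψ x = c • N x) (w : Euc n) :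
    confCov α β ψ N x w = -(c • fderiv ℝ ψ x w) := by
  obtain ⟨hN_diff, hN_unit, hN_normal⟩ := hN.self_of_nhds
  have htangent :=
    h.confMetric_confCov_fderiv_of_normal hum hx hN_diff (hN.mono fun _ hy => hy.2.2) w
  have hlength : confMetric α β (ψ x) (confCov α β ψ N x w) (N x) = 0 := by
    have hconst : fderiv ℝ (fun y => confMetric α β (ψ y) (N y) (N y)) x w = 0 := by
      rw [EventuallyEq.fderiv_eq (f := fun _ => (1 : ℝ)) (hN.mono fun _ hy => hy.2.1),
        fderiv_fun_const]
      rfl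
    rw [fderiv_confMetric (h.differentiableAt hx) hN_diff hN_diff (h.factor_ne x hx),
      confMetric_comm _ (N x)] at hconst
    linarith
  refine eq_neg_of_add_eq_zero_left
    (h.eq_zero_of_confMetric_eq_zero hx hN_unit hN_normal (fun z => ?_) ?_)
  · rw [confMetric_comm, LinearMap.BilinForm.add_left, LinearMap.BilinForm.smul_left, htangent, hη,
      LinearMap.BilinForm.smul_left, hN_unit, h.pullback x hx]
    ring
  · rw [confMetric_comm, LinearMap.BilinForm.add_left, LinearMap.BilinForm.smul_left, hlength,
      hN_normal, mul_zero, add_zero]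

/-- The constant vector is `C = dσ(N) + c σ`, where `σ` is the inverse stereographic projection. -/
lemma exists_isLocallyInSmallSphere_stereoInv (h : IsConfImmersion 1 (1 / 4) U ψ G H)
    (hum : IsUmbilicalOn U G H ψ) (hx : x ∈ U) {N : Euc n → Euc (n + 1)} {c : ℝ}
    (hN : IsUnitNormalNear 1 (1 / 4) ψ N x)
    (hη : ∀ᶠ y in 𝓝 x, meanCurvature G H ψ y = c • N y) {E : Type*} [NormedAddCommGroup E]
    [InnerProductSpace ℝ E] {J : Euc (n + 1) →ₗᵢ[ℝ] E} {v : E} (hv : ‖v‖ = 1)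
    (hJ : ∀ y, ⟪J y, v⟫ = 0) :
    ∃ C, IsLocallyInSmallSphere (stereoInv J v ∘ ψ) C c x := by
  set C : Euc n → E := fun y => fderiv ℝ (stereoInv J v) (ψ y) (N y) + c • stereoInv J v (ψ y)
    with hC
  have hderiv : ∀ᶠ y in 𝓝 x, DifferentiableAt ℝ C y ∧ fderiv ℝ C y = 0 := by
    filter_upwards [h.mem_nhds hx, hN.eventually_nhds, hη] with y hy hNy hηy
    have hψ := h.differentiableAt hy
    obtain ⟨hN_diff, -, hN_normal⟩ := hNy.self_of_nhds
    have hσ : DifferentiableAt ℝ (fun z => stereoInv J v (ψ z)) y :=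
      (hasFDerivAt_stereoInv (ψ y)).differentiableAt.comp y hψ
    have hcσ : DifferentiableAt ℝ (fun z => c • stereoInv J v (ψ z)) y := hσ.const_smul c
    have hdσ : DifferentiableAt ℝ (fun z => fderiv ℝ (stereoInv J v) (ψ z) (N z)) y :=
      (((contDiff_stereoInv.fderiv_right (m := 1) (WithTop.coe_le_coe.2
        (le_top : (1 + 1 : ℕ∞) ≤ ⊤))).differentiable one_ne_zero _).comp y hψ).clm_apply hN_diff
    refine ⟨hdσ.add hcσ, ?_⟩
    ext1 w
    rw [hC, fderiv_fun_add hdσ hcσ, fderiv_fun_const_smul hσ, add_apply,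
      fderiv_fderiv_stereoInv_apply hψ hN_diff, hN_normal, zero_smul, sub_zero,
      h.confCov_unitNormal hum hy hNy hηy, smul_apply, fderiv_stereoInv_comp_apply hψ, map_neg,
      map_smul, neg_add_cancel, zero_apply]
  have hinner : ∀ᶠ y in 𝓝 x, ⟪C y, C y⟫ = 1 + c ^ 2 ∧ ⟪stereoInv J v (ψ y), C y⟫ = c := by
    filter_upwards [hN] with y ⟨_, hN_unit, _⟩
    have horth := inner_stereoInv_fderiv hv hJ (ψ y) (N y)
    simp only [hC, inner_add_left, inner_add_right, inner_smul_left, inner_smul_right,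
      RCLike.conj_to_real, inner_stereoInv_self hv hJ, inner_fderiv_stereoInv hv hJ, hN_unit, horth,
      real_inner_comm (stereoInv J v (ψ y))]
    constructor <;> ring
  refine ⟨C x, hinner.self_of_nhds.1, ?_⟩
  filter_upwards [eventually_eq_of_fderiv_eq_zero hderiv, hinner] with y hCy hy
  rw [← hCy]
  exact hy.2

end Hypersurface

end IsConfImmersion

/-! ### Hypersurfaces in small spheres -/

section TangentFrame

variable {X E : Type*} [NormedAddCommGroup X] [NormedSpace ℝ X] [NormedAddCommGroup E]
  [InnerProductSpace ℝ E] {L : X →L[ℝ] E} {x C C' : E} {c c' : ℝ}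

/-- The map `L` parametrizes tangent vectors, at the point `x`, to the small sphere
`{y | ‖y‖ = 1, ⟪y, C⟫ = c}`, where `C` is normalized as in `IsLocallyInSmallSphere`. -/
structure IsTangentToSmallSphere (L : X →L[ℝ] E) (x C : E) (c : ℝ) : Prop where
  injective : Function.Injective L
  inner_point : ∀ u, ⟪L u, x⟫ = 0
  inner_normal : ∀ u, ⟪L u, C⟫ = 0
  point_self : ⟪x, x⟫ = 1
  point_normal : ⟪x, C⟫ = c
  normal_self : ⟪C, C⟫ = 1 + c ^ 2

namespace IsTangentToSmallSphere

lemma coprod_injective (h : IsTangentToSmallSphere L x C c) :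
    Function.Injective (L.coprod ((toSpanSingleton ℝ x).coprod (toSpanSingleton ℝ C))) := by
  refine (injective_iff_map_eq_zero _).2 fun ⟨u, t, s⟩ hz => ?_
  simp only [coprod_apply, toSpanSingleton_apply] at hz
  have hx := congrArg (⟪·, x⟫) hz
  have hC := congrArg (⟪·, C⟫) hz
  simp only [inner_add_left, inner_smul_left, h.inner_point, h.inner_normal, h.point_self,
    h.point_normal, h.normal_self, real_inner_comm x C, inner_zero_left, RCLike.conj_to_real]
    at hx hC
  have hs : s = 0 := by linear_combination hC - c * hx
  have ht : t = 0 := by linear_combination hx - c * hs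
  rw [hs, ht, zero_smul, zero_smul, add_zero, add_zero, map_eq_zero_iff _ h.injective] at hz
  rw [hs, ht, hz, Prod.mk_zero_zero, Prod.mk_zero_zero]

variable [FiniteDimensional ℝ X] [FiniteDimensional ℝ E]

lemma coprod_surjective (h : IsTangentToSmallSphere L x C c)
    (hdim : Module.finrank ℝ X + 2 = Module.finrank ℝ E) :
    Function.Surjective (L.coprod ((toSpanSingleton ℝ x).coprod (toSpanSingleton ℝ C))) :=
  (LinearMap.injective_iff_surjective_of_finrank_eq_finrank (by simpa using hdim)).1
    h.coprod_injective

lemma sub_eq_smul_or_add_eq_smul (h : IsTangentToSmallSphere L x C c)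
    (h' : IsTangentToSmallSphere L x C' c')
    (hdim : Module.finrank ℝ X + 2 = Module.finrank ℝ E) :
    C' - C = (c' - c) • x ∨ C' + C = (c' + c) • x := by
  obtain ⟨⟨u, t, s⟩, hC'⟩ := h.coprod_surjective hdim C'
  simp only [coprod_apply, toSpanSingleton_apply] at hC'
  have hu := congrArg (⟪L u, ·⟫) hC'
  simp only [inner_add_right, inner_smul_right, h.inner_point, h.inner_normal, h'.inner_normal,
    mul_zero, add_zero, inner_self_eq_zero] at hu
  rw [hu, zero_add] at hC'
  have ht : t + s * c = c' := by
    rw [← h'.point_normal, ← hC', inner_add_right, inner_smul_right, inner_smul_right,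
      h.point_self, h.point_normal, mul_one]
  have hs : s * s = 1 := by
    have hself := h'.normal_self
    rw [← hC'] at hself
    simp only [inner_add_left, inner_add_right, inner_smul_left, inner_smul_right, h.point_self,
      h.point_normal, h.normal_self, real_inner_comm x C, RCLike.conj_to_real] at hself
    rw [← ht] at hself
    linarith
  rw [← hC', ← ht]
  rcases mul_self_eq_one_iff.1 hs with rfl | rfl
  · left; module
  · right; module

end IsTangentToSmallSphere

end TangentFrame

section SphericalImmersion

variable {X E : Type*} [NormedAddCommGroup X] [NormedSpace ℝ X] [NormedAddCommGroup E]
  [InnerProductSpace ℝ E] {F : X → E} {x₀ : X} {C C' : E} {c c' : ℝ}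

/-- The map `F` takes values in the unit sphere and is a `C¹` immersion at `x₀`. -/
structure IsSphericalImmersionAt (F : X → E) (x₀ : X) : Prop where
  contDiffAt : ContDiffAt ℝ 1 F x₀
  injective : Function.Injective (fderiv ℝ F x₀)
  inner_self : ∀ y, ⟪F y, F y⟫ = 1

lemma IsLocallyInSmallSphere.neg {X : Type*} [TopologicalSpace X] {F : X → E} {x : X}
    (h : IsLocallyInSmallSphere F C c x) : IsLocallyInSmallSphere F (-C) (-c) x :=
  ⟨by rw [inner_neg_neg, h.1, neg_sq], h.2.mono fun y hy => by rw [inner_neg_right, hy]⟩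

lemma IsLocallyInSmallSphere.comp {X Y : Type*} [TopologicalSpace X] [TopologicalSpace Y]
    {F : X → E} {f : Y → X} {y : Y} (h : IsLocallyInSmallSphere F C c (f y))
    (hf : ContinuousAt f y) : IsLocallyInSmallSphere (F ∘ f) C c y :=
  ⟨h.1, hf.eventually h.2⟩

lemma IsLocallyInSmallSphere.congr {X : Type*} [TopologicalSpace X] {F F' : X → E} {x : X}
    (h : IsLocallyInSmallSphere F C c x) (hF : F =ᶠ[𝓝 x] F') : IsLocallyInSmallSphere F' C c x :=
  ⟨h.1, by filter_upwards [h.2, hF] with y hy hyF using hyF ▸ hy⟩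

lemma IsLocallyInSmallSphere.eventually {X : Type*} [TopologicalSpace X] {F : X → E} {x : X}
    (h : IsLocallyInSmallSphere F C c x) : ∀ᶠ y in 𝓝 x, IsLocallyInSmallSphere F C c y :=
  h.2.eventually_nhds.mono fun _ hy => ⟨h.1, hy⟩

namespace IsSphericalImmersionAt

lemma isTangentToSmallSphere (hF : IsSphericalImmersionAt F x₀)
    (h : IsLocallyInSmallSphere F C c x₀) :
    IsTangentToSmallSphere (fderiv ℝ F x₀) (F x₀) C c := by
  have hdiff := hF.contDiffAt.differentiableAt one_ne_zero
  refine ⟨hF.injective, fun u => ?_, fun u => ?_, hF.inner_self x₀, h.2.self_of_nhds, h.1⟩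
  · have hderiv := fderiv_inner_apply ℝ hdiff hdiff u
    simp only [hF.inner_self, fderiv_fun_const, Pi.zero_apply, zero_apply,
      real_inner_comm (fderiv ℝ F x₀ u)] at hderiv
    linarith
  · have hderiv := fderiv_inner_apply ℝ hdiff (differentiableAt_const C) u
    rw [EventuallyEq.fderiv_eq (f := fun _ => c) h.2] at hderiv
    simpa using hderiv.symm

lemma not_eventually_eq [Nontrivial X] (hF : IsSphericalImmersionAt F x₀) :
    ¬ ∀ᶠ y in 𝓝 x₀, F y = F x₀ := fun hconst => by
  obtain ⟨u, hu⟩ := exists_ne (0 : X)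
  refine hu (hF.injective ?_)
  rw [EventuallyEq.fderiv_eq (f := fun _ => F x₀) hconst, fderiv_fun_const, Pi.zero_apply,
    zero_apply, zero_apply]

lemma eq_of_sub_eq_smul [Nontrivial X] (hF : IsSphericalImmersionAt F x₀)
    (h : IsLocallyInSmallSphere F C c x₀) (h' : IsLocallyInSmallSphere F C' c' x₀)
    (hsub : C' - C = (c' - c) • F x₀) : C' = C ∧ c' = c := by
  suffices hc : c' - c = 0 by
    rw [hc, zero_smul] at hsub
    exact ⟨sub_eq_zero.1 hsub, sub_eq_zero.1 hc⟩
  by_contra hne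
  have hnorm : ∀ y, ‖F y‖ = 1 := fun y => by
    rw [norm_eq_sqrt_real_inner, hF.inner_self, Real.sqrt_one]
  refine hF.not_eventually_eq ?_
  filter_upwards [h.2, h'.2] with y hy hy'
  refine (inner_eq_one_iff_of_norm_eq_one (hnorm y) (hnorm x₀)).1 (mul_left_cancel₀ hne ?_)
  rw [← real_inner_smul_right, ← hsub, inner_sub_right, hy, hy', mul_one]

variable [FiniteDimensional ℝ X] [FiniteDimensional ℝ E]

lemma eq_or_eq_neg [Nontrivial X] (hF : IsSphericalImmersionAt F x₀)
    (h : IsLocallyInSmallSphere F C c x₀) (h' : IsLocallyInSmallSphere F C' c' x₀)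
    (hdim : Module.finrank ℝ X + 2 = Module.finrank ℝ E) :
    (C' = C ∧ c' = c) ∨ (C' = -C ∧ c' = -c) := by
  rcases (hF.isTangentToSmallSphere h).sub_eq_smul_or_add_eq_smul (hF.isTangentToSmallSphere h')
    hdim with hsub | hadd
  · exact .inl (hF.eq_of_sub_eq_smul h h' hsub)
  · exact .inr (hF.eq_of_sub_eq_smul h.neg h' (by rw [sub_neg_eq_add, sub_neg_eq_add, hadd]))

end IsSphericalImmersionAt

lemma smul_add_smul_eq_self {y : E} {t s : ℝ} (hy : ⟪y, y⟫ = 1) (hyC : ⟪y, C⟫ = c)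
    (hC : ⟪C, C⟫ = 1 + c ^ 2) (ht : -1 < t)
    (hz : ⟪(1 + t) • y + s • C, (1 + t) • y + s • C⟫ = 1)
    (hzC : ⟪(1 + t) • y + s • C, C⟫ = c) : (1 + t) • y + s • C = y := by
  simp only [inner_add_left, inner_add_right, inner_smul_left, inner_smul_right, hy, hyC, hC,
    real_inner_comm y C, RCLike.conj_to_real] at hz hzC
  have hs : s * (1 + c ^ 2) = -(t * c) := by linarith
  have htt : t * (t + 2) = 0 := by
    linear_combination (1 + c ^ 2) * hz - (s * (1 + c ^ 2) - t * c + 2 * (1 + t) * c) * hs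
  have ht0 : t = 0 := (mul_eq_zero.1 htt).resolve_right (by linarith)
  have hs0 : s = 0 := by
    rw [ht0, zero_mul, neg_zero] at hs
    exact (mul_eq_zero.1 hs).resolve_right (by positivity)
  rw [ht0, hs0, add_zero, one_smul, zero_smul, add_zero]

/-- The map `(y, t, s) ↦ (1 + t) F y + s C` is a submersion at `(x₀, 0, 0)`, and its values on the
small sphere have `t = s = 0`. -/
lemma IsSphericalImmersionAt.eventually_mem_range [FiniteDimensional ℝ X] [FiniteDimensional ℝ E]
    (hF : IsSphericalImmersionAt F x₀) (hdim : Module.finrank ℝ X + 2 = Module.finrank ℝ E)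
    (hC : ⟪C, C⟫ = 1 + c ^ 2) (hFC : ∀ y, ⟪F y, C⟫ = c) :
    ∀ᶠ z in 𝓝 (F x₀), ⟪z, z⟫ = 1 → ⟪z, C⟫ = c → z ∈ Set.range F := by
  have := FiniteDimensional.complete ℝ X
  have := FiniteDimensional.complete ℝ E
  let Θ : X × ℝ × ℝ → E := fun z => (1 + z.2.1) • F z.1 + z.2.2 • C
  have hΘ : HasStrictFDerivAt Θ ((fderiv ℝ F x₀).coprod
      ((toSpanSingleton ℝ (F x₀)).coprod (toSpanSingleton ℝ C))) (x₀, 0, 0) := by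
    have hfst := (hF.contDiffAt.hasStrictFDerivAt one_ne_zero).comp (x₀, (0 : ℝ), (0 : ℝ))
      (hasStrictFDerivAt_fst (𝕜 := ℝ))
    have hsnd := hasStrictFDerivAt_snd (𝕜 := ℝ) (p := (x₀, (0 : ℝ), (0 : ℝ)))
    refine (((hsnd.fst.const_add 1).smul hfst).add (hsnd.snd.smul_const C)).congr_fderiv ?_
    ext <;> simp
  have hmap := hΘ.map_nhds_eq_of_surj (LinearMap.range_eq_top.2
    ((hF.isTangentToSmallSphere ⟨hC, .of_forall hFC⟩).coprod_surjective hdim))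
  have hΘ₀ : Θ (x₀, 0, 0) = F x₀ := by simp [Θ]
  have hmem : {z : X × ℝ × ℝ | -1 < z.2.1} ∈ 𝓝 (x₀, (0 : ℝ), (0 : ℝ)) :=
    (isOpen_lt continuous_const (continuous_fst.comp continuous_snd)).mem_nhds (by simp)
  have himage := image_mem_map (m := Θ) hmem
  rw [hmap, hΘ₀] at himage
  filter_upwards [himage]
  rintro _ ⟨⟨y, t, s⟩, ht, rfl⟩ hz hzC
  exact ⟨y, (smul_add_smul_eq_self (hF.inner_self y) (hFC y) hC ht hz hzC).symm⟩

end SphericalImmersion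

section Sphere

variable {m n : ℕ} {M : Type*} [TopologicalSpace M] [ChartedSpace (Euc m) M]
  [IsManifold (𝓡 m) ∞ M] {g : MetricTensor m M}

lemma inner_coe_sphere_self (y : UnitSphere n) : ⟪(y : Euc (n + 1)), (y : Euc (n + 1))⟫ = 1 := by
  rw [real_inner_self_eq_norm_sq, norm_eq_of_mem_sphere, one_pow]

lemma isSphericalImmersionAt_chart {φ : M → UnitSphere n} (hg : ∀ p u, g p u u = 0 → u = 0)
    (hφ : IsIsometricImmersion g (sphereMetric n) φ) {e : OpenPartialHomeomorph M (Euc m)}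
    (he : e ∈ atlas (Euc m) M) {x : Euc m} (hx : x ∈ e.target) :
    IsSphericalImmersionAt ((Subtype.val ∘ φ) ∘ e.symm) x := by
  have := Fact.mk (@finrank_euclideanSpace_fin ℝ _ (n + 1))
  have hval : ContMDiff (𝓡 n) (𝓡 (n + 1)) ∞ (Subtype.val : UnitSphere n → Euc (n + 1)) :=
    contMDiff_coe_sphere
  refine ⟨((hval.comp hφ.1).contMDiffAt.comp x
    (contMDiffAt_symm_of_mem_atlas he hx)).contDiffAt.of_le (by simp),
    (injective_iff_map_eq_zero _).2 fun u hu => mfderiv_symm_injective he hx ?_,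
    fun y => inner_coe_sphere_self _⟩
  rw [← mfderiv_mfderiv_symm he hx ((hval.comp hφ.1).mdifferentiableAt (by simp)),
    mfderiv_comp_apply _ (hval.mdifferentiableAt (by simp)) (hφ.1.mdifferentiableAt (by simp))]
    at hu
  refine (hg _ _ ?_).trans (map_zero _).symm
  rw [← hφ.2, sphereMetric, hu]
  exact inner_zero_left (E := Euc (n + 1)) _

variable {φ : M → UnitSphere (m + 1)}

lemma exists_isLocallyInSmallSphere (hm : 2 ≤ m) (hg : ∀ p u, g p u u = 0 → u = 0)
    (hφ : IsIsometricImmersion g (sphereMetric (m + 1)) φ)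
    (hum : IsTotallyUmbilical g (sphereMetric (m + 1)) φ)
    (hbih : IsFBiharmonic g (sphereMetric (m + 1)) φ) (p : M) :
    ∃ C c, (c = 0 ∨ c = 1) ∧ IsLocallyInSmallSphere (Subtype.val ∘ φ) C c p := by
  obtain ⟨f, -, hpos, hf⟩ := hbih
  set e := chartAt (Euc m) p
  set e' := chartAt (Euc (m + 1)) (φ p)
  have he : e ∈ atlas (Euc m) M := chart_mem_atlas _ p
  have he' : e' ∈ atlas (Euc (m + 1)) (UnitSphere (m + 1)) := chart_mem_atlas _ (φ p)
  have hp : p ∈ e.source := mem_chart_source _ p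
  have hp' : φ p ∈ e'.source := mem_chart_source _ (φ p)
  have h := isConfImmersion_chart hg (isSpaceFormMetric_sphere _) hφ he he'
  have hum' := hum.isUmbilicalOn_chart he he'
  have hx := mem_chartDomain hp hp'
  obtain ⟨N, c, hc, hN, hη⟩ := h.exists_isUnitNormalNear_smul_eq_meanCurvature hum' hx hm
    (Nat.lt_succ_self m) (by norm_num) (hpos _) (hf.fBitension_chart he he')
  obtain ⟨J, v, hv, hJ, hsymm⟩ := exists_stereoInv_eq_symm he'
  obtain ⟨C, hC⟩ := h.exists_isLocallyInSmallSphere_stereoInv hum' hx hN hη hv hJ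
  refine ⟨C, c, hc, (hC.comp (e.continuousAt hp)).congr ?_⟩
  filter_upwards [e.open_source.mem_nhds hp,
    (e'.open_source.preimage hφ.1.continuous).mem_nhds hp'] with q hq hq'
  simp only [← hsymm, Function.comp_apply, e.left_inv hq, e'.left_inv hq']

lemma exists_forall_inner_eq [ConnectedSpace M] (hm : 2 ≤ m) (hg : ∀ p u, g p u u = 0 → u = 0)
    (hφ : IsIsometricImmersion g (sphereMetric (m + 1)) φ)
    (hum : IsTotallyUmbilical g (sphereMetric (m + 1)) φ)
    (hbih : IsFBiharmonic g (sphereMetric (m + 1)) φ) :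
    ∃ C c, (c = 0 ∨ c = 1) ∧ ⟪C, C⟫ = 1 + c ^ 2 ∧ ∀ p, ⟪(φ p : Euc (m + 1 + 1)), C⟫ = c := by
  have hlocal := exists_isLocallyInSmallSphere hm hg hφ hum hbih
  obtain ⟨p₀⟩ : Nonempty M := inferInstance
  obtain ⟨C, c, hc, hC⟩ := hlocal p₀
  have : Nontrivial (Euc m) := Module.nontrivial_of_finrank_pos (R := ℝ) (by simp; omega)
  have hopen : IsOpen {p | IsLocallyInSmallSphere (Subtype.val ∘ φ) C c p} :=
    isOpen_iff_eventually.2 fun p hp => hp.eventually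
  have hclosed : IsClosed {p | IsLocallyInSmallSphere (Subtype.val ∘ φ) C c p} := by
    refine isOpen_compl_iff.1 (isOpen_iff_eventually.2 fun p hp => ?_)
    obtain ⟨C', c', -, hC'⟩ := hlocal p
    filter_upwards [hC'.eventually] with q hq' hq
    set e := chartAt (Euc m) q
    have hqe : q ∈ e.source := mem_chart_source _ q
    have hcont := e.continuousAt_symm (e.map_source hqe)
    rw [← e.left_inv hqe] at hq hq'
    refine hp ?_
    rcases (isSphericalImmersionAt_chart hg hφ (chart_mem_atlas _ q)
      (e.map_source hqe)).eq_or_eq_neg (hq'.comp hcont) (hq.comp hcont) (by simp)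
      with ⟨rfl, rfl⟩ | ⟨rfl, rfl⟩
    exacts [hC', hC'.neg]
  have huniv := IsClopen.eq_univ ⟨hclosed, hopen⟩ ⟨p₀, hC⟩
  exact ⟨C, c, hc, hC.1, fun p => ((Set.eq_univ_iff_forall.1 huniv p)).2.self_of_nhds⟩

lemma isPartOfUpToIsometry_of_eventually {M : Type*} {φ : M → UnitSphere (m + 1)}
    {C : Euc (m + 1 + 1)} {c a κ : ℝ} (hC : ⟪C, C⟫ = κ ^ 2) (hκ : κ ≠ 0) (hκa : κ * a = c)
    (hφC : ∀ p, ⟪(φ p : Euc (m + 1 + 1)), C⟫ = c)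
    (hopen : ∀ p, ∀ᶠ z in 𝓝 (φ p : Euc (m + 1 + 1)), ⟪z, z⟫ = 1 → ⟪z, C⟫ = c →
      z ∈ Set.range (Subtype.val ∘ φ)) :
    IsPartOfUpToIsometry φ {y | (y : Euc (m + 1 + 1)) 0 = a} := by
  have hnorm : ‖C‖ = ‖EuclideanSpace.single (0 : Fin (m + 1 + 1)) κ‖ := by
    rw [norm_eq_sqrt_real_inner, hC, Real.sqrt_sq_eq_abs, PiLp.norm_single,
      Real.norm_eq_abs]
  set Ψ := (ℝ ∙ (C - EuclideanSpace.single (0 : Fin (m + 1 + 1)) κ))ᗮ.reflection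
  have hΨC : Ψ C = EuclideanSpace.single 0 κ := Submodule.reflection_sub hnorm
  have hcoord : ∀ y, y 0 = a ↔ ⟪Ψ.symm y, C⟫ = c := fun y => by
    rw [← Ψ.inner_map_map, Ψ.apply_symm_apply, hΨC, EuclideanSpace.inner_single_right, ← hκa,
      RCLike.conj_to_real, mul_right_inj' hκ]
  refine ⟨Ψ, {y | ∀ᶠ z : UnitSphere (m + 1) in 𝓝 y, (z : Euc (m + 1 + 1)) 0 = a →
    ∃ p, (z : Euc (m + 1 + 1)) = Ψ (φ p)}, isOpen_iff_eventually.2 fun y hy => hy.eventually_nhds,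
    Set.Subset.antisymm ?_ fun y hy => hy.1.self_of_nhds hy.2⟩
  rintro y ⟨p, hp⟩
  have hy : Ψ.symm y = φ p := by rw [hp, Ψ.symm_apply_apply]
  refine ⟨?_, (hcoord y).2 (by rw [hy, hφC])⟩
  have hcont : ContinuousAt (fun z : UnitSphere (m + 1) => Ψ.symm z) y :=
    (Ψ.symm.continuous.comp continuous_subtype_val).continuousAt
  filter_upwards [hcont.eventually (hy.symm ▸ hopen p)] with z hz hza
  obtain ⟨q, hq⟩ := hz (by rw [Ψ.symm.inner_map_map, inner_coe_sphere_self]) ((hcoord z).1 hza)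
  exact ⟨q, (Ψ.eq_symm_apply.1 hq).symm⟩

lemma isPartOfUpToIsometry (hg : ∀ p u, g p u u = 0 → u = 0)
    (hφ : IsIsometricImmersion g (sphereMetric (m + 1)) φ) {C : Euc (m + 1 + 1)} {c a κ : ℝ}
    (hC : ⟪C, C⟫ = 1 + c ^ 2) (hκ : κ ^ 2 = 1 + c ^ 2) (hκa : κ * a = c)
    (hφC : ∀ p, ⟪(φ p : Euc (m + 1 + 1)), C⟫ = c) :
    IsPartOfUpToIsometry φ {y | (y : Euc (m + 1 + 1)) 0 = a} := by
  refine isPartOfUpToIsometry_of_eventually (hC.trans hκ.symm)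
    (pow_ne_zero_iff two_ne_zero |>.1 (hκ ▸ by positivity)) hκa hφC fun p => ?_
  have hp : p ∈ (chartAt (Euc m) p).source := mem_chart_source _ p
  have hopen := (isSphericalImmersionAt_chart hg hφ (chart_mem_atlas _ p)
    ((chartAt (Euc m) p).map_source hp)).eventually_mem_range (by simp) hC fun y => hφC _
  rw [Function.comp_apply, (chartAt (Euc m) p).left_inv hp] at hopen
  filter_upwards [hopen] with z hz hz1 hzC using Set.range_comp_subset_range _ _ (hz hz1 hzC)

end Sphere

end FBiharm

open FBiharm in
theorem corollary3p7 (m : ℕ) (hm : 2 ≤ m)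
    (M : Type*) [TopologicalSpace M] [ChartedSpace (Euc m) M] [IsManifold (𝓡 m) ∞ M]
    (g : Bundle.ContMDiffRiemannianMetric (𝓡 m) ∞ (Euc m) (fun p : M => TangentSpace (𝓡 m) p)) :
    (∀ φ : M → Euc (m + 1),
      IsIsometricImmersion (metricOf g) (euclideanMetric (m + 1)) φ →
      IsTotallyUmbilical (metricOf g) (euclideanMetric (m + 1)) φ →
      IsFBiharmonic (metricOf g) (euclideanMetric (m + 1)) φ →
      IsTotallyGeodesic (metricOf g) (euclideanMetric (m + 1)) φ) ∧
    (∀ φ : M → HypSpace (m + 1),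
      IsIsometricImmersion (metricOf g) (hyperbolicMetric (m + 1)) φ →
      IsTotallyUmbilical (metricOf g) (hyperbolicMetric (m + 1)) φ →
      IsFBiharmonic (metricOf g) (hyperbolicMetric (m + 1)) φ →
      IsTotallyGeodesic (metricOf g) (hyperbolicMetric (m + 1)) φ) ∧
    (ConnectedSpace M → ∀ φ : M → UnitSphere (m + 1),
      IsIsometricImmersion (metricOf g) (sphereMetric (m + 1)) φ →
      IsTotallyUmbilical (metricOf g) (sphereMetric (m + 1)) φ →
      IsFBiharmonic (metricOf g) (sphereMetric (m + 1)) φ →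
      IsPartOfUpToIsometry φ (greatSphere m) ∨ IsPartOfUpToIsometry φ (smallSphere m)) := by
  have hg := metricOf_self_eq_zero g
  refine ⟨fun φ hφ hum hbih => ?_, fun φ hφ hum hbih => ?_, fun _ φ hφ hum hbih => ?_⟩
  · exact isTotallyGeodesic_of_nonpos_curvature hm hg (isSpaceFormMetric_euclidean (m + 1))
      (by norm_num) hφ hum hbih
  · exact isTotallyGeodesic_of_nonpos_curvature hm hg (isSpaceFormMetric_hyperbolic (m + 1))
      (by norm_num) hφ hum hbih
  · obtain ⟨C, c, rfl | rfl, hC, hφC⟩ := exists_forall_inner_eq hm hg hφ hum hbih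
    · exact .inl (isPartOfUpToIsometry hg hφ (κ := 1) hC (by norm_num) (by norm_num) hφC)
    · have hsqrt : √(2 : ℝ) ^ 2 = 1 + 1 ^ 2 := by norm_num
      exact .inr (isPartOfUpToIsometry hg hφ hC hsqrt (mul_one_div_cancel (by positivity)) hφC)
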